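/- \textbf{Theorem (generalized Huyghebaert--De Raedt scheme).} Let $q\ge 1$ and let $a_1,\dots,a_{q+1}$, $b_1,\dots,b_q$ be real numbers that define an order-$n$ product formula for two operators, i.e. for any two operators $A,B$ on a finite-dimensional Hilbert space $$e^{(A+B)\tau}=e^{Aa_1\tau}e^{Bb_1\tau}\cdots e^{Aa_q\tau}e^{Bb_q\tau}e^{Aa_{q+1}\tau}+O(\tau^{n+1})\qquad(\tau\to0).$$ Put $c_1=a_1$, $c_k=a_k-d_{k-1}$ $(2\le k\le q)$, $d_k=b_k-c_k$ $(1\le k\le q)$, and for a step size $\Delta t$ put $$L_k=\Delta t\sum_{j=k}^{q}(c_j+d_j),\qquad L_{q+1}=0,\qquad R_k=\Delta t\Big(d_k+\sum_{j=k+1}^{q}(c_j+d_j)\Big)\qquad(1\le k\le q).$$ Let $\Lambda\ge1$, let $\mathcal H$ be a complex Hilbert space, and let $H_1,\dots,H_\Lambda$ be smooth ($C^\infty$, in operator norm) functions from $\mathbb R$ to the bounded operators on $\mathcal H$; put $H(t)=\sum_{k=1}^{\Lambda}H_k(t)$. For an operator function $G$ and any real $s,t$ write $\exp_{\mathcal T}\big(-i\int_s^tG(r)\,dr\big)$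 for the time-ordered exponential (the sum of the Dyson series, with oriented integrals if $t<s$). Let $\mathcal U(t,s)=\exp_{\mathcal T}\big(-i\int_s^tH(r)\,dr\big)$, $$\widetilde U_F(t',t)=\prod_{k=1}^{\Lambda}\exp_{\mathcal T}\Big(-i\int_t^{t'}H_k(s)\,ds\Big),\qquad \widetilde U_B(t',t)=\prod_{k=\Lambda}^{1}\exp_{\mathcal T}\Big(-i\int_t^{t'}H_k(s)\,ds\Big),$$ where the factors are written from left to right in the indicated order of $k$, and $$\widetilde U_n(t+\Delta t,t)=\widetilde U_F(t+L_1,t+R_1)\,\widetilde U_B(t+R_1,t+L_2)\cdots\widetilde U_F(t+L_q,t+R_q)\,\widetilde U_B(t+R_q,t).$$ (i) The scheme has order $n$: for every $T$ there are $C$ and $\delta>0$ such that $$\big\|\widetilde U_n(t+\Delta t,t)-\mathcal U(t+\Delta t,t)\big\|\le C|\Delta t|^{n+1}\qquad\text{for all } |t|\le T,\ |\Delta t|\le\delta.$$ (ii) Call each operator $\exp_{\mathcal T}\big(-i\int_t^{t'}H_k(s)\,ds\big)$ a gate. After neighbouring gates of the same $H_k$ over adjacent time spans have been merged into one, the $2\Lambda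 q$ factors of $\widetilde U_n(t+\Delta t,t)$ become exactly $2\Lambda q-(2q-1)$ gates, with the same product, for all $t$ and $\Delta t$. (iii) This is the gate number of the time-independent formula $$\Big(\prod_{k=1}^{\Lambda}e^{A_kc_1\tau}\Big)\Big(\prod_{k=\Lambda}^{1}e^{A_kd_1\tau}\Big)\cdots\Big(\prod_{k=1}^{\Lambda}e^{A_kc_q\tau}\Big)\Big(\prod_{k=\Lambda}^{1}e^{A_kd_q\tau}\Big)$$ for bounded operators $A_1,\dots,A_\Lambda$ on $\mathcal H$: after neighbouring exponentials of the same $A_k$ have been merged, its $2\Lambda q$ factors become exactly $2\Lambda q-(2q-1)$ exponentials, with the same product. -/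

import Mathlib

open scoped Topology ContDiff

noncomputable section

namespace HDR

/-! ### Time-ordered exponentials -/

/-- The `m`-th term of the Dyson series of `exp_T (-i ∫_s^t G(r) dr)`, as a function of `t`:
the oriented iterated integral
`(-i)^m ∫_s^t dr₁ ∫_s^{r₁} dr₂ ⋯ ∫_s^{r_{m-1}} dr_m G(r₁) G(r₂) ⋯ G(r_m)`. -/
def dysonTerm {E : Type*} [NormedAddCommGroup E] [InnerProductSpace ℂ E]
    (G : ℝ → E →L[ℂ] E) (s : ℝ) : ℕ → ℝ → (E →L[ℂ] E)
  | 0, _ => 1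
  | m + 1, t => ∫ r in s..t, (-Complex.I) • (G r * dysonTerm G s m r)

/-- The time-ordered exponential `exp_T (-i ∫_s^t G(r) dr)`, i.e. the sum of the Dyson series.
The order of the time arguments is (final time, initial time); the final time may precede the
initial one, in which case the integrals are oriented and this is the backward propagator. -/
def timeOrderedExp {E : Type*} [NormedAddCommGroup E] [InnerProductSpace ℂ E]
    (G : ℝ → E →L[ℂ] E) (t s : ℝ) : E →L[ℂ] E :=
  ∑' m : ℕ, dysonTerm G s m t

/-! ### Time-independent product formulas

All sequences are indexed from `0`: a formula with `q` cycles has the weights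
`a 0, …, a q` and `b 0, …, b (q - 1)`; the other values are never used. -/

/-- `e^{A a₀ τ} e^{B b₀ τ} ⋯ e^{A a_{q-1} τ} e^{B b_{q-1} τ} e^{A a_q τ}`. -/
def twoOperatorProduct {E : Type*} [NormedAddCommGroup E] [InnerProductSpace ℂ E]
    (q : ℕ) (a b : ℕ → ℝ) (A B : E →L[ℂ] E) (τ : ℝ) : E →L[ℂ] E :=
  ((List.range q).map fun j =>
      NormedSpace.exp ((a j * τ) • A) * NormedSpace.exp ((b j * τ) • B)).prod
    * NormedSpace.exp ((a q * τ) • A)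

/-- The weights `a`, `b` define a product formula of order `n` with `q` cycles for two operators:
for any two operators on a finite-dimensional Hilbert space,
`e^{(A+B)τ} = e^{A a₀ τ} e^{B b₀ τ} ⋯ e^{B b_{q-1} τ} e^{A a_q τ} + O(τ^{n+1})`. -/
def IsProductFormula (n q : ℕ) (a b : ℕ → ℝ) : Prop :=
  ∀ (d : ℕ) (A B : EuclideanSpace ℂ (Fin d) →L[ℂ] EuclideanSpace ℂ (Fin d)),
    (fun τ : ℝ => NormedSpace.exp (τ • (A + B)) - twoOperatorProduct q a b A B τ)
      =O[𝓝 0] fun τ : ℝ => τ ^ (n + 1)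

/-- `c₀ = a₀` and `c_{k+1} = a_{k+1} - d_k`, where `d_k = b_k - c_k`. -/
def weightC (a b : ℕ → ℝ) : ℕ → ℝ
  | 0 => a 0
  | k + 1 => a (k + 1) - (b k - weightC a b k)

/-- `d_k = b_k - c_k`. -/
def weightD (a b : ℕ → ℝ) (k : ℕ) : ℝ := b k - weightC a b k

/-- The time-independent product formula with `q` cycles for the operators `A_1, …, A_Λ`:
`(∏_{k=1}^Λ e^{A_k c₀ τ}) (∏_{k=Λ}^1 e^{A_k d₀ τ}) ⋯
 (∏_{k=1}^Λ e^{A_k c_{q-1} τ}) (∏_{k=Λ}^1 e^{A_k d_{q-1} τ})`. -/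
def multiOperatorProduct {E : Type*} [NormedAddCommGroup E] [InnerProductSpace ℂ E]
    {Λ : ℕ} (q : ℕ) (a b : ℕ → ℝ) (A : Fin Λ → E →L[ℂ] E) (τ : ℝ) : E →L[ℂ] E :=
  ((List.range q).map fun j =>
    ((List.finRange Λ).map fun k => NormedSpace.exp ((weightC a b j * τ) • A k)).prod *
    ((List.finRange Λ).reverse.map fun k =>
      NormedSpace.exp ((weightD a b j * τ) • A k)).prod).prod

/-! ### The time-dependent scheme -/

/-- `L_k = Δt ∑_{j=k}^{q-1} (c_j + d_j)`; in particular `L_q = 0`. -/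
def breakL (q : ℕ) (a b : ℕ → ℝ) (Δt : ℝ) (k : ℕ) : ℝ :=
  Δt * ∑ j ∈ Finset.Ico k q, (weightC a b j + weightD a b j)

/-- `R_k = Δt (d_k + ∑_{j=k+1}^{q-1} (c_j + d_j))`. -/
def breakR (q : ℕ) (a b : ℕ → ℝ) (Δt : ℝ) (k : ℕ) : ℝ :=
  Δt * (weightD a b k + ∑ j ∈ Finset.Ico (k + 1) q, (weightC a b j + weightD a b j))

/-- Forward sweep `U_F(t', t) = ∏_{k=1}^Λ exp_T (-i ∫_t^{t'} H_k(s) ds)`. -/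
def forwardSweep {E : Type*} [NormedAddCommGroup E] [InnerProductSpace ℂ E]
    {Λ : ℕ} (H : Fin Λ → ℝ → E →L[ℂ] E) (t' t : ℝ) : E →L[ℂ] E :=
  ((List.finRange Λ).map fun k => timeOrderedExp (H k) t' t).prod

/-- Backward sweep `U_B(t', t) = ∏_{k=Λ}^1 exp_T (-i ∫_t^{t'} H_k(s) ds)`. -/
def backwardSweep {E : Type*} [NormedAddCommGroup E] [InnerProductSpace ℂ E]
    {Λ : ℕ} (H : Fin Λ → ℝ → E →L[ℂ] E) (t' t : ℝ) : E →L[ℂ] E :=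
  ((List.finRange Λ).reverse.map fun k => timeOrderedExp (H k) t' t).prod

/-- One step from `t` to `t + Δt` of the generalized Huyghebaert–De Raedt scheme:
`U_F(t+L₀, t+R₀) U_B(t+R₀, t+L₁) ⋯ U_F(t+L_{q-1}, t+R_{q-1}) U_B(t+R_{q-1}, t)`. -/
def hdrStep {E : Type*} [NormedAddCommGroup E] [InnerProductSpace ℂ E]
    {Λ : ℕ} (q : ℕ) (a b : ℕ → ℝ) (H : Fin Λ → ℝ → E →L[ℂ] E) (t Δt : ℝ) : E →L[ℂ] E :=
  ((List.range q).map fun k =>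
    forwardSweep H (t + breakL q a b Δt k) (t + breakR q a b Δt k) *
    backwardSweep H (t + breakR q a b Δt k) (t + breakL q a b Δt (k + 1))).prod

/-! ### Circuits and gate counts

A circuit is a list of gates; the first gate of the list is the leftmost factor. -/

/-- Merge neighbouring gates of a circuit wherever `join` allows it: `join g g' = some h` means
that the neighbours `g`, `g'` (in this order) are replaced by the single gate `h`. -/
def mergeGates {G : Type*} (join : G → G → Option G) : List G → List G
  | [] => []
  | g :: l =>
    match mergeGates join l with
    | [] => [g]
    | g' :: l' =>
      match join g g' with
      | some h => h :: l'
      | none => g :: g' :: l'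

/-- A gate `exp_T (-i ∫_init^final H_idx(s) ds)`: one query to the time-ordered exponential
of one local Hamiltonian. -/
structure EvolutionGate (Λ : ℕ) where
  idx : Fin Λ
  final : ℝ
  init : ℝ

/-- The operator performed by a circuit of evolution gates. -/
def evolutionCircuitOp {E : Type*} [NormedAddCommGroup E] [InnerProductSpace ℂ E]
    {Λ : ℕ} (H : Fin Λ → ℝ → E →L[ℂ] E) (l : List (EvolutionGate Λ)) : E →L[ℂ] E :=
  (l.map fun g => timeOrderedExp (H g.idx) g.final g.init).prod

open Classical in
/-- Two neighbouring gates of the same local Hamiltonian over adjacent time spans form one gate. -/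
def EvolutionGate.join {Λ : ℕ} (g g' : EvolutionGate Λ) : Option (EvolutionGate Λ) :=
  if g.idx = g'.idx ∧ g.init = g'.final then some ⟨g.idx, g.final, g'.init⟩ else none

/-- The circuit of one step of the scheme: the `2 Λ q` factors of `hdrStep` in their order, with
neighbouring gates merged. -/
def hdrCircuit (Λ q : ℕ) (a b : ℕ → ℝ) (t Δt : ℝ) : List (EvolutionGate Λ) :=
  mergeGates EvolutionGate.join ((List.range q).flatMap fun k =>
    ((List.finRange Λ).map fun i =>
      ⟨i, t + breakL q a b Δt k, t + breakR q a b Δt k⟩) ++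
    ((List.finRange Λ).reverse.map fun i =>
      ⟨i, t + breakR q a b Δt k, t + breakL q a b Δt (k + 1)⟩))

/-- A gate `e^{A_idx duration}` of a time-independent product formula. -/
structure ExpGate (Λ : ℕ) where
  idx : Fin Λ
  duration : ℝ

/-- The operator performed by a circuit of exponential gates. -/
def expCircuitOp {E : Type*} [NormedAddCommGroup E] [InnerProductSpace ℂ E]
    {Λ : ℕ} (A : Fin Λ → E →L[ℂ] E) (l : List (ExpGate Λ)) : E →L[ℂ] E :=
  (l.map fun g => NormedSpace.exp (g.duration • A g.idx)).prod

/-- Two neighbouring exponentials of the same operator form one gate. -/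
def ExpGate.join {Λ : ℕ} (g g' : ExpGate Λ) : Option (ExpGate Λ) :=
  if g.idx = g'.idx then some ⟨g.idx, g.duration + g'.duration⟩ else none

/-- The circuit of the time-independent formula: the `2 Λ q` factors of `multiOperatorProduct` in
their order, with neighbouring gates merged. -/
def timeIndependentCircuit (Λ q : ℕ) (a b : ℕ → ℝ) (τ : ℝ) : List (ExpGate Λ) :=
  mergeGates ExpGate.join ((List.range q).flatMap fun j =>
    ((List.finRange Λ).map fun i => ⟨i, weightC a b j * τ⟩) ++
    ((List.finRange Λ).reverse.map fun i => ⟨i, weightD a b j * τ⟩))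

end HDR

end

/-!
The order statement reduces to the hypothesis about two time-independent matrices in two moves.

**From matrices to arbitrary linear operators.** Order `n` for matrices is a finite list of
polynomial identities in two noncommuting letters, one for each degree `m ≤ n`. The letters act on
the span of the words of length at most `n` (longer words being zero), and there these words are
linearly independent; the identities therefore hold in the free algebra, hence for any two linear
operators on any real vector space. This is `IsProductFormula.formalCoeff_eq`.

**The scheme is a two-operator product formula.** Consider smooth operator-valued functions of
`(t, s)`, where `s` is an auxiliary variable, and the two flows `splitFlow`
* `(e^{hA} f)(t, s) = f(t, s - h)`,
* `(e^{hB} f)(t, s) = Z(t, s)⁻¹ Z(t - h, s + h) f(t - h, s + h)` with `Z(t, s) = U_B(t + s, t)`.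

On the line `s = 0`, the product `e^{hA} e^{hB}` acts as `f ↦ U_F(t, t - h) f(t - h, 0)` and
`e^{hB} e^{hA}` as `f ↦ U_B(t, t - h) f(t - h, 0)`, because `U_F(t, s) = U_B(s, t)⁻¹`. Splitting
`b_k = c_k + d_k` and `a_{k+1} = d_k + c_{k+1}`, the product formula applied to the constant function
`1` is exactly one step of the scheme (`flowProduct_splitFlow`). Moreover `A + B` acts on that line
as `-∂_t - i H(t)` (`splitGenerator_add_apply`), the generator of the flow
`f ↦ U(t, t - h) f(t - h, 0)` of the exact evolution.

All flows involved are translations conjugated by an invertible smooth function (`transport`). They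
have Taylor expansions with a remainder that is uniform on bounded sets, and the expansions can be
multiplied (`ErrorScale.flowProduct_sub_mem`); comparing the two Taylor polynomials of degree `n`
gives the error bound `norm_hdrStep_sub_le`.

For the gate counts, the last gate of each of the `2 q` sweeps but the last has the same index as
the first gate of the next sweep, and no other neighbours share an index, so exactly `2 q - 1`
mergers take place (`length_mergeGates_sweeps`). Mergers preserve the product by the evolution property
`timeOrderedExp_mul`, which follows from uniqueness for linear differential equations.
-/

noncomputable section

namespace HDR

/-! ### Time-ordered exponentials of continuous generators -/

section Dyson

variable {E : Type*} [NormedAddCommGroup E] [InnerProductSpace ℂ E]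

@[simp]
lemma timeOrderedExp_self (G : ℝ → E →L[ℂ] E) (s : ℝ) : timeOrderedExp G s s = 1 := by
  rw [timeOrderedExp, tsum_eq_single 0]
  · rfl
  · rintro (_ | m) hm
    · exact absurd rfl hm
    · simp [dysonTerm]

variable [CompleteSpace E] {G : ℝ → E →L[ℂ] E}

lemma continuous_dysonTerm (hG : Continuous G) (s : ℝ) (m : ℕ) :
    Continuous (dysonTerm G s m) := by
  induction m with
  | zero => exact continuous_const
  | succ m ih =>
    have h : Continuous fun r => (-Complex.I) • (G r * dysonTerm G s m r) :=
      (hG.mul ih).const_smul (-Complex.I)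
    exact intervalIntegral.continuous_primitive (fun _ _ => h.intervalIntegrable _ _) s

lemma hasDerivAt_dysonTerm_succ (hG : Continuous G) (s : ℝ) (m : ℕ) (t : ℝ) :
    HasDerivAt (dysonTerm G s (m + 1)) ((-Complex.I) • (G t * dysonTerm G s m t)) t := by
  have h : Continuous fun r => (-Complex.I) • (G r * dysonTerm G s m r) :=
    (hG.mul (continuous_dysonTerm hG s m)).const_smul (-Complex.I)
  exact intervalIntegral.integral_hasDerivAt_right (h.intervalIntegrable _ _)
    (h.stronglyMeasurableAtFilter _ _) h.continuousAt

/-- The bound `(K |r - s|) ^ m / m!` that makes the Dyson series converge. -/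
lemma norm_dysonTerm_le {K : ℝ} {s t : ℝ} (hK : ∀ r ∈ Set.uIcc s t, ‖G r‖ ≤ K) (m : ℕ) :
    ∀ r ∈ Set.uIcc s t, ‖dysonTerm G s m r‖ ≤ (K * |r - s|) ^ m / m.factorial := by
  have hK0 : 0 ≤ K := (norm_nonneg _).trans (hK s Set.left_mem_uIcc)
  induction m with
  | zero =>
    intro r _
    have h : ‖(1 : E →L[ℂ] E)‖ ≤ 1 := ContinuousLinearMap.norm_id_le
    simpa [dysonTerm] using h
  | succ m ih =>
    intro r hr
    have hsub : ∀ x ∈ Set.uIoc s r, x ∈ Set.uIcc s t := fun x hx =>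
      Set.uIcc_subset_uIcc Set.left_mem_uIcc hr (Set.uIoc_subset_uIcc hx)
    have hint : IntervalIntegrable (fun x : ℝ => K * ((K * |x - s|) ^ m / m.factorial))
        MeasureTheory.volume s r := by
      apply Continuous.intervalIntegrable
      fun_prop
    calc ‖dysonTerm G s (m + 1) r‖
        ≤ |∫ x in s..r, K * ((K * |x - s|) ^ m / m.factorial)| := by
          refine intervalIntegral.norm_integral_le_abs_of_norm_le ?_ hint
          refine (MeasureTheory.ae_restrict_iff' measurableSet_uIoc).2
            (Filter.Eventually.of_forall fun x hx => ?_)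
          rw [norm_smul, norm_neg, Complex.norm_I, one_mul]
          exact (norm_mul_le _ _).trans (mul_le_mul (hK x (hsub x hx)) (ih x (hsub x hx))
            (norm_nonneg _) hK0)
      _ = (K * |r - s|) ^ (m + 1) / (m + 1).factorial := by
          have h : (fun x : ℝ => K * ((K * |x - s|) ^ m / m.factorial))
              = fun x => (K ^ (m + 1) / m.factorial) * |x - s| ^ m := by
            ext x; rw [mul_pow]; ring
          rw [h, intervalIntegral.integral_const_mul, abs_mul,
            intervalIntegral.abs_intervalIntegral_eq, integral_pow_abs_sub_uIoc,
            abs_of_nonneg (by positivity), abs_of_nonneg (by positivity), Nat.factorial_succ]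
          push_cast
          rw [mul_pow]
          field_simp

/-- The time-ordered exponential solves `∂ₜ U(t, s) = -i G(t) U(t, s)`. -/
lemma hasDerivAt_timeOrderedExp (hG : Continuous G) (s t : ℝ) :
    HasDerivAt (fun t => timeOrderedExp G t s) ((-Complex.I) • (G t * timeOrderedExp G t s)) t := by
  set R : ℝ := |s| + |t| + 1 with hR
  obtain ⟨K, hK⟩ := (isCompact_Icc (a := -R) (b := R)).exists_bound_of_continuousOn hG.continuousOn
  have hs : s ∈ Set.Ioo (-R) R := by
    constructor <;> linarith [abs_nonneg t, neg_abs_le s, le_abs_self s]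
  have ht : t ∈ Set.Ioo (-R) R := by
    constructor <;> linarith [abs_nonneg s, neg_abs_le t, le_abs_self t]
  have hK0 : 0 ≤ K := (norm_nonneg _).trans (hK s (Set.Ioo_subset_Icc_self hs))
  have hD : ∀ (m : ℕ), ∀ r ∈ Set.Ioo (-R) R,
      ‖dysonTerm G s m r‖ ≤ (K * (2 * R)) ^ m / m.factorial := by
    intro m r hr
    have hsub : Set.uIcc s r ⊆ Set.Icc (-R) R :=
      Set.uIcc_subset_Icc (Set.Ioo_subset_Icc_self hs) (Set.Ioo_subset_Icc_self hr)
    refine (norm_dysonTerm_le (fun x hx => hK x (hsub hx)) m r Set.right_mem_uIcc).trans ?_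
    have : |r - s| ≤ 2 * R := by
      rw [abs_le]; constructor <;> linarith [hs.1, hs.2, hr.1, hr.2]
    gcongr
  have hsumm : Summable fun m : ℕ => K * ((K * (2 * R)) ^ m / m.factorial) :=
    (Real.summable_pow_div_factorial _).mul_left K
  have hterm : ∀ r ∈ Set.Ioo (-R) R, Summable fun m => dysonTerm G s m r := fun r hr =>
    Summable.of_norm_bounded (Real.summable_pow_div_factorial _) (fun m => hD m r hr)
  have key : HasDerivAt (fun z => ∑' m, dysonTerm G s (m + 1) z)
      (∑' m, (-Complex.I) • (G t * dysonTerm G s m t)) t := by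
    have h0 : Summable fun m => dysonTerm G s (m + 1) t :=
      (summable_nat_add_iff (f := fun m => dysonTerm G s m t) 1).2 (hterm t ht)
    refine hasDerivAt_tsum_of_isPreconnected (g := fun m => dysonTerm G s (m + 1))
      (g' := fun m y => (-Complex.I) • (G y * dysonTerm G s m y))
      hsumm isOpen_Ioo isPreconnected_Ioo
      (fun m y _ => hasDerivAt_dysonTerm_succ hG s m y) (fun m y hy => ?_) ht h0 ht
    rw [norm_smul, norm_neg, Complex.norm_I, one_mul]
    exact (norm_mul_le _ _).trans (mul_le_mul (hK y (Set.Ioo_subset_Icc_self hy)) (hD m y hy)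
      (norm_nonneg _) hK0)
  have e1 : (∑' m, (-Complex.I) • (G t * dysonTerm G s m t))
      = (-Complex.I) • (G t * timeOrderedExp G t s) :=
    (((hterm t ht).hasSum.mul_left (G t)).const_smul (-Complex.I)).tsum_eq
  rw [e1] at key
  refine (key.const_add (1 : E →L[ℂ] E)).congr_of_eventuallyEq ?_
  filter_upwards [isOpen_Ioo.mem_nhds ht] with r hr
  exact (hterm r hr).tsum_eq_zero_add

/-- Uniqueness of solutions of the linear equation `X' = -i G X`. -/
lemma eq_of_hasDerivAt_generator (hG : Continuous G) {X Y : ℝ → E →L[ℂ] E}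
    (hX : ∀ t, HasDerivAt X ((-Complex.I) • (G t * X t)) t)
    (hY : ∀ t, HasDerivAt Y ((-Complex.I) • (G t * Y t)) t) (s : ℝ) (h : X s = Y s) : X = Y := by
  ext1 t
  set R : ℝ := |s| + |t| + 1 with hR
  obtain ⟨K, hK⟩ := (isCompact_Icc (a := -R) (b := R)).exists_bound_of_continuousOn hG.continuousOn
  have hs : s ∈ Set.Ioo (-R) R := by
    constructor <;> linarith [abs_nonneg t, neg_abs_le s, le_abs_self s]
  have ht : t ∈ Set.Ioo (-R) R := by
    constructor <;> linarith [abs_nonneg s, neg_abs_le t, le_abs_self t]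
  refine ODE_solution_unique_of_mem_Ioo (v := fun t x => (-Complex.I) • (G t * x))
    (s := fun _ => Set.univ) (K := K.toNNReal) (fun r hr => ?_) hs
    (fun r _ => ⟨hX r, trivial⟩) (fun r _ => ⟨hY r, trivial⟩) h ht
  refine (LipschitzWith.of_dist_le_mul fun x y => ?_).lipschitzOnWith
  rw [dist_eq_norm, dist_eq_norm, ← smul_sub, ← mul_sub, norm_smul, norm_neg, Complex.norm_I,
    one_mul]
  refine (norm_mul_le _ _).trans ?_
  gcongr
  exact (hK r (Set.Ioo_subset_Icc_self hr)).trans (Real.le_coe_toNNReal K)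

/-- The evolution property `U(t, s) U(s, r) = U(t, r)`. -/
lemma timeOrderedExp_mul (hG : Continuous G) (t s r : ℝ) :
    timeOrderedExp G t s * timeOrderedExp G s r = timeOrderedExp G t r := by
  have h := eq_of_hasDerivAt_generator hG
    (X := fun t => timeOrderedExp G t s * timeOrderedExp G s r)
    (Y := fun t => timeOrderedExp G t r)
    (fun t => by
      have := (hasDerivAt_timeOrderedExp hG s t).mul_const (timeOrderedExp G s r)
      rwa [smul_mul_assoc, mul_assoc] at this)
    (fun t => hasDerivAt_timeOrderedExp hG r t) s (by simp)
  exact congrFun h t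

lemma timeOrderedExp_mul_swap (hG : Continuous G) (t s : ℝ) :
    timeOrderedExp G t s * timeOrderedExp G s t = 1 := by
  rw [timeOrderedExp_mul hG, timeOrderedExp_self]

/-- Smoothness in the final time, by bootstrapping the differential equation. -/
lemma contDiff_timeOrderedExp_left (hG : ContDiff ℝ ∞ G) (s : ℝ) :
    ContDiff ℝ ∞ fun t => timeOrderedExp G t s := by
  have hd := hasDerivAt_timeOrderedExp hG.continuous s
  refine contDiff_infty.2 fun n => ?_
  induction n with
  | zero => exact contDiff_zero.2 (continuous_iff_continuousAt.2 fun t => (hd t).continuousAt)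
  | succ n ih =>
    rw [Nat.cast_succ, contDiff_succ_iff_deriv]
    refine ⟨fun t => (hd t).differentiableAt, by simp, ?_⟩
    rw [show deriv (fun t => timeOrderedExp G t s) = _ from funext fun t => (hd t).deriv]
    exact ((contDiff_infty.1 hG n).mul ih).const_smul (-Complex.I)

/-- Smoothness in the initial time: `U(s, t)` is the inverse of `U(t, s)`. -/
lemma contDiff_timeOrderedExp_right (hG : ContDiff ℝ ∞ G) (s : ℝ) :
    ContDiff ℝ ∞ fun t => timeOrderedExp G s t := by
  have h : (fun t => timeOrderedExp G s t) = fun t => Ring.inverse (timeOrderedExp G t s) := by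
    ext1 t
    exact (Ring.inverse_unit ⟨_, _, timeOrderedExp_mul_swap hG.continuous t s,
      timeOrderedExp_mul_swap hG.continuous s t⟩).symm
  rw [h, contDiff_iff_contDiffAt]
  intro t
  exact (contDiffAt_ringInverse ℝ (⟨_, _, timeOrderedExp_mul_swap hG.continuous t s,
      timeOrderedExp_mul_swap hG.continuous s t⟩ : (E →L[ℂ] E)ˣ)).comp t
      (contDiff_timeOrderedExp_left hG s).contDiffAt

/-- Joint smoothness in both times, obtained from `U(t, s) = U(t, 0) U(0, s)`. -/
lemma contDiff_timeOrderedExp (hG : ContDiff ℝ ∞ G) :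
    ContDiff ℝ ∞ fun p : ℝ × ℝ => timeOrderedExp G p.1 p.2 := by
  have h : (fun p : ℝ × ℝ => timeOrderedExp G p.1 p.2)
      = fun p => timeOrderedExp G p.1 0 * timeOrderedExp G 0 p.2 := by
    ext1 p; rw [timeOrderedExp_mul hG.continuous]
  rw [h]
  exact ((contDiff_timeOrderedExp_left hG 0).comp contDiff_fst).mul
    ((contDiff_timeOrderedExp_right hG 0).comp contDiff_snd)

/-- The derivative in the initial time, from differentiating `U(t, s) U(s, t) = 1`. -/
lemma hasDerivAt_timeOrderedExp_right_self (hG : ContDiff ℝ ∞ G) (t : ℝ) :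
    HasDerivAt (fun s => timeOrderedExp G t s) (Complex.I • G t) t := by
  have hd : DifferentiableAt ℝ (fun s => timeOrderedExp G t s) t :=
    (contDiff_timeOrderedExp_right hG t).differentiable (by simp) t
  have h := hd.hasDerivAt.mul (hasDerivAt_timeOrderedExp hG.continuous t t)
  have h1 : (fun s => timeOrderedExp G t s) * (fun s => timeOrderedExp G s t) = fun _ => 1 :=
    funext fun s => timeOrderedExp_mul_swap hG.continuous t s
  rw [h1] at h
  have h2 := h.unique (hasDerivAt_const t _)
  simp only [timeOrderedExp_self, mul_one, one_mul, neg_smul] at h2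
  have h3 := hd.hasDerivAt
  rwa [eq_of_sub_eq_zero ((sub_eq_add_neg _ _).trans h2)] at h3

end Dyson

/-! ### Formal expansion of a product of flows -/

/-- The coefficients, as a formal power series in `h`, of
`e^{x₁ h X_{β₁}} e^{x₂ h X_{β₂}} ⋯ f`, where the list holds the pairs `(x₁, β₁), (x₂, β₂), …`. -/
def formalCoeff {M : Type*} [AddCommGroup M] [Module ℝ M] (X : Bool → Module.End ℝ M) :
    List (ℝ × Bool) → M → ℕ → M
  | [], f, m => if m = 0 then f else 0
  | (x, β) :: l, f, m => ∑ j ∈ Finset.range (m + 1),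
      (x ^ (m - j) / (m - j).factorial) • (X β ^ (m - j)) (formalCoeff X l f j)

/-- The product `T_{β₁}(x₁ h) T_{β₂}(x₂ h) ⋯ f` of the one-parameter families `T false`, `T true`. -/
def flowProduct {M : Type*} [AddCommGroup M] [Module ℝ M] (T : Bool → ℝ → M →ₗ[ℝ] M) :
    List (ℝ × Bool) → M → ℝ → M
  | [], f, _ => f
  | (x, β) :: l, f, h => T β (x * h) (flowProduct T l f h)

/-- A notion of curves `h ↦ F h` in `M` of size `O(h ^ k)`, one linear space `mem k` for each `k`. -/
structure ErrorScale (M : Type*) [AddCommGroup M] [Module ℝ M] where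
  mem : ℕ → Submodule ℝ (ℝ → M)
  pow_smul_mem : ∀ (j k : ℕ) (F : ℝ → M), F ∈ mem k → (fun h => h ^ j • F h) ∈ mem (j + k)

/-- The family `T` preserves the error scale and has the Taylor expansion of `e^{h X}`. -/
structure ErrorScale.IsFlow {M : Type*} [AddCommGroup M] [Module ℝ M] (O : ErrorScale M)
    (T : ℝ → M →ₗ[ℝ] M) (X : Module.End ℝ M) : Prop where
  map_mem : ∀ (x : ℝ) (k : ℕ) (F : ℝ → M), F ∈ O.mem k → (fun h => T (x * h) (F h)) ∈ O.mem k
  taylor : ∀ (x : ℝ) (p : ℕ) (f : M),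
    (fun h => T (x * h) f - ∑ k ∈ Finset.range p, ((x * h) ^ k / k.factorial) • (X ^ k) f) ∈ O.mem p

section

variable {M : Type*} [AddCommGroup M] [Module ℝ M]

/-- Taylor expansions of flows can be multiplied. Each coefficient `h ^ j c_j` of the expansion of
`flowProduct T l f h` is expanded only to the order `n + 1 - j` that is needed in total. -/
theorem ErrorScale.flowProduct_sub_mem (O : ErrorScale M) {T : Bool → ℝ → M →ₗ[ℝ] M}
    {X : Bool → Module.End ℝ M} (hT : ∀ β, O.IsFlow (T β) (X β)) (n : ℕ) (f : M)
    (l : List (ℝ × Bool)) :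
    (fun h => flowProduct T l f h - ∑ m ∈ Finset.range (n + 1), h ^ m • formalCoeff X l f m)
      ∈ O.mem (n + 1) := by
  induction l with
  | nil =>
    convert (O.mem (n + 1)).zero_mem using 1
    ext1 h
    simp [flowProduct, formalCoeff]
  | cons y l ih =>
    obtain ⟨x, β⟩ := y
    have h1 := (hT β).map_mem x _ _ ih
    have h2 : (∑ j ∈ Finset.range (n + 1), fun h : ℝ => h ^ j • (T β (x * h) (formalCoeff X l f j) -
        ∑ k ∈ Finset.range (n + 1 - j),
          ((x * h) ^ k / k.factorial) • (X β ^ k) (formalCoeff X l f j))) ∈ O.mem (n + 1) := by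
      refine Submodule.sum_mem _ fun j hj => ?_
      have := O.pow_smul_mem j _ _ ((hT β).taylor x (n + 1 - j) (formalCoeff X l f j))
      rwa [Nat.add_sub_of_le (Finset.mem_range.1 hj).le] at this
    convert (O.mem (n + 1)).add_mem h1 h2 using 1
    ext1 h
    have h3 := Finset.sum_range_diag_flip (n + 1) fun j k =>
      h ^ j • ((x * h) ^ k / k.factorial) • (X β ^ k) (formalCoeff X l f j)
    simp only [Pi.add_apply, Finset.sum_apply, smul_sub, Finset.sum_sub_distrib, Finset.smul_sum,
      map_sub, map_sum, map_smul, flowProduct, formalCoeff]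
    rw [← h3, sub_add_sub_cancel]
    congr 1
    refine Finset.sum_congr rfl fun m _ => Finset.sum_congr rfl fun j hj => ?_
    rw [smul_smul, smul_smul, mul_pow]
    congr 1
    have : h ^ m = h ^ j * h ^ (m - j) := by
      rw [← pow_add, Nat.add_sub_of_le (Finset.mem_range_succ_iff.1 hj)]
    rw [this]
    ring

lemma map_pow_apply {N : Type*} [AddCommGroup N] [Module ℝ N] {X : Module.End ℝ M}
    {Y : Module.End ℝ N} (π : M →ₗ[ℝ] N) (h : ∀ f, π (X f) = Y (π f)) (k : ℕ) (f : M) :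
    π ((X ^ k) f) = (Y ^ k) (π f) := by
  induction k generalizing f with
  | zero => simp
  | succ k ih => rw [pow_succ, pow_succ, Module.End.mul_apply, ih, h]; rfl

/-- Linear maps intertwining the generators intertwine the formal coefficients. -/
lemma map_formalCoeff {N : Type*} [AddCommGroup N] [Module ℝ N] {X : Bool → Module.End ℝ M}
    {Y : Bool → Module.End ℝ N} (π : M →ₗ[ℝ] N) (h : ∀ β f, π (X β f) = Y β (π f))
    (l : List (ℝ × Bool)) (f : M) (m : ℕ) :
    π (formalCoeff X l f m) = formalCoeff Y l (π f) m := by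
  induction l generalizing m with
  | nil => rw [formalCoeff, formalCoeff]; split_ifs <;> simp
  | cons y l ih =>
    obtain ⟨x, β⟩ := y
    simp only [formalCoeff, map_sum, map_smul, map_pow_apply π (h β), ih]

lemma formalCoeff_zero (X : Bool → Module.End ℝ M) (l : List (ℝ × Bool)) (f : M) :
    formalCoeff X l f 0 = f := by
  induction l with
  | nil => simp [formalCoeff]
  | cons y l ih => simp [formalCoeff, ih]

lemma formalCoeff_one (X : Bool → Module.End ℝ M) (l : List (ℝ × Bool)) (f : M) :
    formalCoeff X l f 1 = (l.map fun y => y.1 • X y.2 f).sum := by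
  induction l with
  | nil => simp [formalCoeff]
  | cons y l ih => simp [formalCoeff, Finset.sum_range_succ, ih, formalCoeff_zero]

end

/-! ### Transport flows on smooth functions -/

section Transport

variable (P 𝔸 : Type*) [NormedAddCommGroup P] [NormedSpace ℝ P] [NormedRing 𝔸] [NormedAlgebra ℝ 𝔸]

/-- The real vector space of smooth functions `P → 𝔸`. -/
def smoothFun : Submodule ℝ (P → 𝔸) where
  carrier := {f | ContDiff ℝ ∞ f}
  add_mem' {f g} (hf : ContDiff ℝ ∞ f) (hg : ContDiff ℝ ∞ g) := hf.add hg
  zero_mem' := (contDiff_const : ContDiff ℝ ∞ fun _ : P => (0 : 𝔸))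
  smul_mem' c f (hf : ContDiff ℝ ∞ f) := hf.const_smul c

variable {P 𝔸}

lemma contDiff_smoothFun (f : smoothFun P 𝔸) : ContDiff ℝ ∞ (f : P → 𝔸) := f.2

lemma differentiable_smoothFun (f : smoothFun P 𝔸) : Differentiable ℝ (f : P → 𝔸) :=
  (contDiff_smoothFun f).differentiable (by simp)

/-- `(T_h f)(p) = Z̄(p) Z(p + h v) f(p + h v)`: translation along `v`, conjugated by the
multiplication operator `Z` with inverse `Z̄`. -/
def transport (v : P) (Z Zi : smoothFun P 𝔸) (h : ℝ) : smoothFun P 𝔸 →ₗ[ℝ] smoothFun P 𝔸 where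
  toFun f := ⟨fun p => Zi.1 p * (Z.1 (p + h • v) * f.1 (p + h • v)),
    (contDiff_smoothFun Zi).mul (((contDiff_smoothFun Z).comp (contDiff_id.add contDiff_const)).mul
      ((contDiff_smoothFun f).comp (contDiff_id.add contDiff_const)))⟩
  map_add' f g := by ext p; simp [mul_add]
  map_smul' c f := by ext p; simp

/-- The generator `f ↦ Z̄ ∂_v (Z f)` of `transport v Z Z̄`. -/
def transportGenerator (v : P) (Z Zi : smoothFun P 𝔸) : Module.End ℝ (smoothFun P 𝔸) where
  toFun f := ⟨fun p => Zi.1 p * fderiv ℝ (fun q => Z.1 q * f.1 q) p v,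
    (contDiff_smoothFun Zi).mul ((((contDiff_smoothFun Z).mul
      (contDiff_smoothFun f)).fderiv_right (m := ∞) (by simp)).clm_apply contDiff_const)⟩
  map_add' f g := by
    ext p
    have h : fderiv ℝ (fun q => Z.1 q * f.1 q + Z.1 q * g.1 q) p
        = fderiv ℝ (fun q => Z.1 q * f.1 q) p + fderiv ℝ (fun q => Z.1 q * g.1 q) p :=
      fderiv_fun_add (((differentiable_smoothFun Z).mul (differentiable_smoothFun f)) p)
        (((differentiable_smoothFun Z).mul (differentiable_smoothFun g)) p)
    simp only [Submodule.coe_add, Pi.add_apply, mul_add]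
    rw [h]
    simp [mul_add]
  map_smul' c f := by
    ext p
    have h : fderiv ℝ (fun q => c • (Z.1 q * f.1 q)) p
        = c • fderiv ℝ (fun q => Z.1 q * f.1 q) p :=
      fderiv_fun_const_smul (((differentiable_smoothFun Z).mul (differentiable_smoothFun f)) p) c
    simp only [Submodule.coe_smul, Pi.smul_apply, mul_smul_comm]
    rw [h]
    simp

@[simp]
lemma transport_apply (v : P) (Z Zi : smoothFun P 𝔸) (h : ℝ) (f : smoothFun P 𝔸) (p : P) :
    (transport v Z Zi h f).1 p = Zi.1 p * (Z.1 (p + h • v) * f.1 (p + h • v)) := rfl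

lemma transportGenerator_apply (v : P) (Z Zi f : smoothFun P 𝔸) (p : P) :
    (transportGenerator v Z Zi f).1 p = Zi.1 p * fderiv ℝ (fun q => Z.1 q * f.1 q) p v := rfl

/-- `d/dh T_h f = T_h (X f)`, where `X` is the generator. -/
lemma hasDerivAt_transport {v : P} {Z Zi : smoothFun P 𝔸} (hZ : ∀ p, Z.1 p * Zi.1 p = 1)
    (f : smoothFun P 𝔸) (p : P) (h : ℝ) :
    HasDerivAt (fun h => (transport v Z Zi h f).1 p)
      ((transport v Z Zi h (transportGenerator v Z Zi f)).1 p) h := by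
  have h1 : HasDerivAt (fun h : ℝ => p + h • v) v h := by
    simpa using ((hasDerivAt_id h).smul_const v).const_add p
  have h2 := (((differentiable_smoothFun Z).mul (differentiable_smoothFun f))
    (p + h • v)).hasFDerivAt.comp_hasDerivAt h h1
  have h3 := h2.const_mul (Zi.1 p)
  rw [transport_apply, transportGenerator_apply, ← mul_assoc (Z.1 _), hZ, one_mul]
  exact h3

/-- Local bounds: `h ↦ F h` is `O(h ^ k)` uniformly on bounded sets. -/
def smoothScale (P 𝔸 : Type*) [NormedAddCommGroup P] [NormedSpace ℝ P] [NormedRing 𝔸]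
    [NormedAlgebra ℝ 𝔸] : ErrorScale (smoothFun P 𝔸) where
  mem k :=
    { carrier := {F | ∀ R : ℝ, ∃ C δ : ℝ, 0 < δ ∧ ∀ h : ℝ, |h| ≤ δ → ∀ p : P, ‖p‖ ≤ R →
        ‖(F h).1 p‖ ≤ C * |h| ^ k}
      add_mem' := by
        intro F G hF hG R
        obtain ⟨C, δ, hδ, h1⟩ := hF R
        obtain ⟨C', δ', hδ', h2⟩ := hG R
        refine ⟨C + C', min δ δ', lt_min hδ hδ', fun h hh p hp => ?_⟩
        rw [add_mul]
        exact (norm_add_le _ _).trans (add_le_add (h1 h (hh.trans (min_le_left _ _)) p hp)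
          (h2 h (hh.trans (min_le_right _ _)) p hp))
      zero_mem' := fun R => ⟨0, 1, one_pos, by simp⟩
      smul_mem' := by
        intro c F hF R
        obtain ⟨C, δ, hδ, h1⟩ := hF R
        refine ⟨|c| * C, δ, hδ, fun h hh p hp => ?_⟩
        have : ‖c • (F h).1 p‖ ≤ |c| * C * |h| ^ k := by
          rw [norm_smul, mul_assoc]
          exact mul_le_mul_of_nonneg_left (h1 h hh p hp) (norm_nonneg _)
        exact this }
  pow_smul_mem := by
    intro j k F hF R
    obtain ⟨C, δ, hδ, h1⟩ := hF R
    refine ⟨C, δ, hδ, fun h hh p hp => ?_⟩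
    have : ‖h ^ j • (F h).1 p‖ ≤ C * |h| ^ (j + k) := by
      rw [norm_smul, pow_add, norm_pow, Real.norm_eq_abs, mul_left_comm]
      exact mul_le_mul_of_nonneg_left (h1 h hh p hp) (by positivity)
    exact this

variable [ProperSpace P]

lemma exists_bound_transport {v : P} {Z Zi : smoothFun P 𝔸} (ρ R : ℝ) :
    ∃ C, 0 ≤ C ∧ ∀ h : ℝ, |h| ≤ ρ → ∀ p : P, ‖p‖ ≤ R → ∀ f : smoothFun P 𝔸,
      ‖(transport v Z Zi h f).1 p‖ ≤ C * ‖f.1 (p + h • v)‖ := by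
  obtain ⟨C1, h1⟩ := (isCompact_closedBall (0 : P) R).exists_bound_of_continuousOn
    (contDiff_smoothFun Zi).continuous.continuousOn
  obtain ⟨C2, h2⟩ := (isCompact_closedBall (0 : P) (R + ρ * ‖v‖)).exists_bound_of_continuousOn
    (contDiff_smoothFun Z).continuous.continuousOn
  refine ⟨|C1| * |C2|, by positivity, fun h hh p hp f => ?_⟩
  have h3 : ‖p + h • v‖ ≤ R + ρ * ‖v‖ := by
    refine (norm_add_le _ _).trans (add_le_add hp ?_)
    rw [norm_smul]
    exact mul_le_mul_of_nonneg_right hh (norm_nonneg _)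
  rw [transport_apply, mul_assoc]
  refine (norm_mul_le _ _).trans (mul_le_mul ((h1 p (by simpa using hp)).trans (le_abs_self _))
    ((norm_mul_le _ _).trans ?_) (norm_nonneg _) (abs_nonneg _))
  exact mul_le_mul_of_nonneg_right ((h2 _ (by simpa using h3)).trans (le_abs_self _))
    (norm_nonneg _)

/-- Taylor's formula `T_h f = ∑_{k < n} h ^ k / k! X ^ k f + O(h ^ n)`, uniformly on bounded sets. -/
lemma transport_taylor {v : P} {Z Zi : smoothFun P 𝔸} (hZ : ∀ p, Z.1 p * Zi.1 p = 1)
    (hZ' : ∀ p, Zi.1 p * Z.1 p = 1) (ρ R : ℝ) (n : ℕ) (f : smoothFun P 𝔸) :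
    ∃ C, ∀ h : ℝ, |h| ≤ ρ → ∀ p : P, ‖p‖ ≤ R →
      ‖(transport v Z Zi h f).1 p - ∑ k ∈ Finset.range n,
        (h ^ k / k.factorial) • ((transportGenerator v Z Zi ^ k) f).1 p‖ ≤ C * |h| ^ n := by
  induction n generalizing f with
  | zero =>
    obtain ⟨C, hC0, hC⟩ := exists_bound_transport (v := v) (Z := Z) (Zi := Zi) ρ R
    obtain ⟨C2, h2⟩ := (isCompact_closedBall (0 : P) (R + ρ * ‖v‖)).exists_bound_of_continuousOn
      (contDiff_smoothFun f).continuous.continuousOn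
    refine ⟨C * C2, fun h hh p hp => ?_⟩
    have h3 : ‖p + h • v‖ ≤ R + ρ * ‖v‖ := by
      refine (norm_add_le _ _).trans (add_le_add hp ?_)
      rw [norm_smul]
      exact mul_le_mul_of_nonneg_right hh (norm_nonneg _)
    simpa using (hC h hh p hp f).trans
      (mul_le_mul_of_nonneg_left (h2 _ (by simpa using h3)) hC0)
  | succ n ih =>
    obtain ⟨C, hC⟩ := ih (transportGenerator v Z Zi f)
    refine ⟨|C|, fun h hh p hp => ?_⟩
    -- the derivative of the remainder for `f` is the remainder for the image of `f`
    have hd : ∀ r : ℝ, HasDerivAt (fun r => (transport v Z Zi r f).1 p -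
        ∑ k ∈ Finset.range (n + 1), (r ^ k / k.factorial) • ((transportGenerator v Z Zi ^ k) f).1 p)
        ((transport v Z Zi r (transportGenerator v Z Zi f)).1 p - ∑ k ∈ Finset.range n,
          (r ^ k / k.factorial) •
            ((transportGenerator v Z Zi ^ k) (transportGenerator v Z Zi f)).1 p) r := by
      intro r
      refine (hasDerivAt_transport hZ f p r).sub ?_
      simp_rw [Finset.sum_range_succ']
      have := HasDerivAt.fun_sum (u := Finset.range n) (x := r)
        (A := fun k (r : ℝ) => (r ^ (k + 1) / (k + 1).factorial) •
          ((transportGenerator v Z Zi ^ (k + 1)) f).1 p)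
        (A' := fun k => (r ^ k / k.factorial) •
            ((transportGenerator v Z Zi ^ k) (transportGenerator v Z Zi f)).1 p) (fun k _ => by
          have h1 : HasDerivAt (fun r : ℝ => r ^ (k + 1) / (k + 1).factorial)
              (r ^ k / k.factorial) r := by
            have h2 := (hasDerivAt_pow (k + 1) r).div_const ((k + 1).factorial : ℝ)
            have h3 : ((k + 1 : ℕ) : ℝ) * r ^ (k + 1 - 1) / ((k + 1).factorial : ℝ)
                = r ^ k / k.factorial := by
              rw [Nat.factorial_succ, Nat.cast_mul, Nat.add_sub_cancel,
                mul_div_mul_left _ _ (Nat.cast_ne_zero.2 k.succ_ne_zero)]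
            rwa [h3] at h2
          exact h1.smul_const _)
      simpa using this.add_const (((transportGenerator v Z Zi ^ 0) f).1 p)
    have hmv := Convex.norm_image_sub_le_of_norm_hasDerivWithin_le (s := Set.uIcc 0 h)
      (C := |C| * |h| ^ n) (fun r _ => (hd r).hasDerivWithinAt) (fun r hr => ?_)
      (convex_uIcc 0 h) Set.left_mem_uIcc Set.right_mem_uIcc
    · have h0 : (transport v Z Zi 0 f).1 p - ∑ k ∈ Finset.range (n + 1),
          ((0 : ℝ) ^ k / k.factorial) • ((transportGenerator v Z Zi ^ k) f).1 p = 0 := by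
        rw [Finset.sum_range_succ', Finset.sum_eq_zero (fun k _ => by simp)]
        simp [← mul_assoc, hZ']
      rw [h0, sub_zero, sub_zero, Real.norm_eq_abs, mul_assoc, ← pow_succ] at hmv
      exact hmv
    · have hr' : |r| ≤ |h| := by
        simpa using Set.abs_sub_left_of_mem_uIcc hr
      refine (hC r (hr'.trans hh) p hp).trans ?_
      exact mul_le_mul (le_abs_self C) (pow_le_pow_left₀ (abs_nonneg _) hr' n) (by positivity)
        (abs_nonneg _)

lemma isFlow_transport {v : P} {Z Zi : smoothFun P 𝔸} (hZ : ∀ p, Z.1 p * Zi.1 p = 1)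
    (hZ' : ∀ p, Zi.1 p * Z.1 p = 1) :
    (smoothScale P 𝔸).IsFlow (transport v Z Zi) (transportGenerator v Z Zi) where
  map_mem := by
    intro x k F hF R
    obtain ⟨C1, hC1, h1⟩ := exists_bound_transport (v := v) (Z := Z) (Zi := Zi) |x| R
    obtain ⟨C, δ, hδ, h2⟩ := hF (R + |x| * ‖v‖)
    refine ⟨C1 * C, min δ 1, lt_min hδ one_pos, fun h hh p hp => ?_⟩
    have hx : |x * h| ≤ |x| := by
      rw [abs_mul]
      exact mul_le_of_le_one_right (abs_nonneg _) (hh.trans (min_le_right _ _))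
    have h3 : ‖p + (x * h) • v‖ ≤ R + |x| * ‖v‖ := by
      refine (norm_add_le _ _).trans (add_le_add hp ?_)
      rw [norm_smul]
      exact mul_le_mul_of_nonneg_right hx (norm_nonneg _)
    rw [mul_assoc]
    exact (h1 _ hx p hp _).trans
      (mul_le_mul_of_nonneg_left (h2 h (hh.trans (min_le_left _ _)) _ h3) hC1)
  taylor := by
    intro x n f R
    obtain ⟨C, hC⟩ := transport_taylor (v := v) hZ hZ' |x| R n f
    refine ⟨C * |x| ^ n, 1, one_pos, fun h hh p hp => ?_⟩
    have hx : |x * h| ≤ |x| := by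
      rw [abs_mul]
      exact mul_le_of_le_one_right (abs_nonneg _) hh
    have := hC (x * h) hx p hp
    rw [abs_mul, mul_pow, ← mul_assoc] at this
    convert this using 2
    simp [Finset.sum_apply]

end Transport

/-! ### Products of exponentials in a Banach algebra -/

section Exponential

variable (𝔅 : Type*) [NormedRing 𝔅] [NormedAlgebra ℝ 𝔅]

/-- The error scale given by `F =O[𝓝 0] h ^ k`. -/
def normScale : ErrorScale 𝔅 where
  mem k :=
    { carrier := {F | F =O[𝓝 0] fun h : ℝ => h ^ k}
      add_mem' := fun hF hG => Asymptotics.IsBigO.add hF hG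
      zero_mem' := Asymptotics.isBigO_zero _ _
      smul_mem' := fun c _ hF => Asymptotics.IsBigO.const_smul_left hF c }
  pow_smul_mem := by
    intro j k F hF
    have := (Asymptotics.isBigO_refl (fun h : ℝ => h ^ j) (𝓝 0)).smul hF
    simpa only [smul_eq_mul, ← pow_add] using! this

variable {𝔅}

/-- A polynomial of degree less than `N` which is `O(h ^ N)` vanishes. -/
lemma eq_zero_of_sum_isBigO {u : ℕ → 𝔅} {N : ℕ}
    (hu : (fun h : ℝ => ∑ m ∈ Finset.range N, h ^ m • u m) =O[𝓝 0] fun h : ℝ => h ^ N) :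
    ∀ m < N, u m = 0 := by
  intro m
  induction m using Nat.strong_induction_on with
  | _ m ih =>
    intro hm
    -- the terms before the `m`-th one vanish, those after it are `O(h ^ (m + 1))`
    have hpow : ∀ k, m + 1 ≤ k → (fun h : ℝ => h ^ k) =O[𝓝 0] fun h : ℝ => h ^ (m + 1) :=
      fun k hk => Asymptotics.IsBigO.of_bound 1 (by
        filter_upwards [Metric.closedBall_mem_nhds (0 : ℝ) one_pos] with h hh
        rw [one_mul, norm_pow, norm_pow]
        exact pow_le_pow_of_le_one (norm_nonneg _) (by simpa using hh) hk)
    have h1 : (fun h : ℝ => h ^ m • u m) =O[𝓝 0] fun h : ℝ => h ^ (m + 1) := by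
      have h2 : (fun h : ℝ => ∑ k ∈ Finset.range N \ {m}, h ^ k • u k)
          =O[𝓝 0] fun h : ℝ => h ^ (m + 1) := by
        refine Asymptotics.IsBigO.fun_sum fun k hk => ?_
        rw [Finset.mem_sdiff, Finset.mem_range, Finset.mem_singleton] at hk
        rcases lt_or_gt_of_ne hk.2 with hlt | hgt
        · simpa [ih k hlt hk.1] using Asymptotics.isBigO_zero _ _
        · simpa using (hpow k hgt).smul (Asymptotics.isBigO_refl (fun _ : ℝ => u k) _) |>.trans
            (Asymptotics.isBigO_of_le' (c := ‖u k‖) _ fun h => by rw [norm_smul, mul_comm])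
      refine ((hu.trans (hpow N hm)).sub h2).congr_left fun h => ?_
      have := Finset.sum_sdiff (f := fun k => h ^ k • u k)
        (Finset.singleton_subset_iff.2 (Finset.mem_range.2 hm))
      rw [← this, Finset.sum_singleton, add_sub_cancel_left]
    obtain ⟨C, hC⟩ := h1.bound
    have h3 : ∀ᶠ h : ℝ in 𝓝[≠] 0, ‖u m‖ ≤ C * |h| := by
      filter_upwards [nhdsWithin_le_nhds hC, self_mem_nhdsWithin] with h hh hne
      have hpos : 0 < |h| ^ m := pow_pos (abs_pos.2 hne) m
      rw [norm_smul, norm_pow, norm_pow, Real.norm_eq_abs, pow_succ, mul_left_comm] at hh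
      exact le_of_mul_le_mul_left hh hpos
    have h4 : Filter.Tendsto (fun h : ℝ => C * |h|) (𝓝[≠] 0) (𝓝 0) := by
      have : Continuous fun h : ℝ => C * |h| := by fun_prop
      simpa using (this.tendsto 0).mono_left nhdsWithin_le_nhds
    exact norm_le_zero_iff.1 (ge_of_tendsto h4 h3)

lemma isFlow_exp [CompleteSpace 𝔅] (X : 𝔅) :
    (normScale 𝔅).IsFlow (fun h => LinearMap.mulLeft ℝ (NormedSpace.exp (h • X)))
      (LinearMap.mulLeft ℝ X) where
  map_mem := by
    intro x k F hF
    have hexp : Continuous (NormedSpace.exp : 𝔅 → 𝔅) :=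
      continuous_iff_continuousAt.2 fun y => (NormedSpace.exp_analytic (𝕂 := ℝ) y).continuousAt
    have hc : Continuous fun h : ℝ => NormedSpace.exp ((x * h) • X) := hexp.comp (by fun_prop)
    have h1 : (fun h : ℝ => NormedSpace.exp ((x * h) • X)) =O[𝓝 0] fun _ => (1 : ℝ) :=
      (hc.tendsto 0).isBigO_one ℝ
    simpa using! h1.mul hF
  taylor := by
    intro x p f
    have h1 := (NormedSpace.exp_hasFPowerSeriesAt_zero (𝕂 := ℝ)
      (𝔸 := 𝔅)).isBigO_sub_partialSum_pow p
    have h2 : Filter.Tendsto (fun h : ℝ => (x * h) • X) (𝓝 0) (𝓝 0) := by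
      have : Continuous fun h : ℝ => (x * h) • X := by fun_prop
      simpa using this.tendsto 0
    have h3 : (fun h : ℝ => ‖(x * h) • X‖ ^ p) =O[𝓝 0] fun h : ℝ => h ^ p := by
      refine Asymptotics.IsBigO.pow ?_ p
      refine Asymptotics.IsBigO.norm_left (Asymptotics.isBigO_of_le' (c := |x| * ‖X‖) _ fun h => ?_)
      rw [norm_smul, norm_mul, Real.norm_eq_abs, Real.norm_eq_abs]
      exact le_of_eq (by ring)
    have h4 := ((h1.comp_tendsto h2).trans h3).mul
      (Asymptotics.isBigO_const_const f (one_ne_zero (α := ℝ)) (𝓝 0))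
    simp only [mul_one] at h4
    refine Asymptotics.IsBigO.congr_left h4 fun h => ?_
    simp [FormalMultilinearSeries.partialSum, NormedSpace.expSeries_apply_eq, sub_mul,
      Finset.sum_mul, LinearMap.pow_mulLeft, smul_pow, smul_smul, div_eq_inv_mul]

end Exponential

/-! ### The order conditions hold for arbitrary linear operators -/

/-- The factors `e^{b_j h B} e^{a_{j+1} h A} ⋯` of `r` cycles starting with number `j`; the
operator `A` has index `false` and `B` has index `true`. -/
def cycleFactors (a b : ℕ → ℝ) : ℕ → ℕ → List (ℝ × Bool)
  | 0, _ => []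
  | r + 1, j => (b j, true) :: (a (j + 1), false) :: cycleFactors a b r (j + 1)

lemma twoOperatorProduct_eq {E : Type*} [NormedAddCommGroup E] [InnerProductSpace ℂ E]
    (q : ℕ) (a b : ℕ → ℝ) (X : Bool → E →L[ℂ] E) (τ : ℝ) :
    twoOperatorProduct q a b (X false) (X true) τ =
      (((a 0, false) :: cycleFactors a b q 0).map fun y =>
        NormedSpace.exp ((y.1 * τ) • X y.2)).prod := by
  have key : ∀ r j : ℕ,
      ((List.range' j r).map fun j =>
        NormedSpace.exp ((a j * τ) • X false) * NormedSpace.exp ((b j * τ) • X true)).prod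
      * NormedSpace.exp ((a (j + r) * τ) • X false) =
      (((a j, false) :: cycleFactors a b r j).map fun y =>
        NormedSpace.exp ((y.1 * τ) • X y.2)).prod := by
    intro r
    induction r with
    | zero => intro j; simp [cycleFactors]
    | succ r ih =>
      intro j
      have := ih (j + 1)
      rw [List.range'_succ, List.map_cons, List.prod_cons, mul_assoc,
        show j + (r + 1) = j + 1 + r by omega, this]
      simp [cycleFactors, mul_assoc]
  rw [twoOperatorProduct, List.range_eq_range']
  simpa using key q 0

lemma flowProduct_exp {𝔅 : Type*} [NormedRing 𝔅] [NormedAlgebra ℝ 𝔅] (X : Bool → 𝔅)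
    (l : List (ℝ × Bool)) (h : ℝ) :
    flowProduct (fun β h => LinearMap.mulLeft ℝ (NormedSpace.exp (h • X β))) l 1 h =
      (l.map fun y => NormedSpace.exp ((y.1 * h) • X y.2)).prod := by
  induction l with
  | nil => rfl
  | cons y l ih => simp [flowProduct, ih]

/-- The order conditions, for operators on a finite-dimensional Hilbert space. -/
lemma IsProductFormula.formalCoeff_operator {n q : ℕ} {a b : ℕ → ℝ}
    (hab : IsProductFormula n q a b)
    {d : ℕ} (X : Bool → EuclideanSpace ℂ (Fin d) →L[ℂ] EuclideanSpace ℂ (Fin d))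
    {m : ℕ} (hm : m ≤ n) :
    formalCoeff (fun β => LinearMap.mulLeft ℝ (X β)) ((a 0, false) :: cycleFactors a b q 0) 1 m =
      ((m.factorial : ℝ)⁻¹) • (X false + X true) ^ m := by
  have h1 := (normScale _).flowProduct_sub_mem (fun β => isFlow_exp (X β)) n 1
    ((a 0, false) :: cycleFactors a b q 0)
  have h2 := (isFlow_exp (X false + X true)).taylor 1 (n + 1) 1
  have h3 := Asymptotics.IsBigO.add (Asymptotics.IsBigO.sub h2 h1)
    (hab d (X false) (X true)).neg_left
  refine (sub_eq_zero.1 (eq_zero_of_sum_isBigO (N := n + 1) (u := fun m =>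
    formalCoeff (fun β => LinearMap.mulLeft ℝ (X β)) ((a 0, false) :: cycleFactors a b q 0) 1 m -
      ((m.factorial : ℝ)⁻¹) • (X false + X true) ^ m) ?_ m (Nat.lt_succ_of_le hm)))
  refine h3.congr_left fun h => ?_
  rw [flowProduct_exp, ← twoOperatorProduct_eq]
  simp only [one_mul, LinearMap.pow_mulLeft, LinearMap.mulLeft_apply, mul_one, smul_sub,
    Finset.sum_sub_distrib, smul_smul, div_eq_mul_inv]
  abel

section Words

/-- The linear map `w ↦ X_{w₁} X_{w₂} ⋯ f` on the free vector space on words `w`. -/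
def wordMap {M : Type*} [AddCommGroup M] [Module ℝ M] (X : Bool → Module.End ℝ M) (f : M) :
    (List Bool →₀ ℝ) →ₗ[ℝ] M :=
  Finsupp.linearCombination ℝ fun w : List Bool => w.foldr (fun β g => X β g) f

/-- Prefixing a letter, on the free vector space on words. -/
def consMap (β : Bool) : Module.End ℝ (List Bool →₀ ℝ) := Finsupp.lmapDomain ℝ ℝ (List.cons β)

lemma consMap_mem_supported {k : ℕ} {x : List Bool →₀ ℝ}
    (hx : x ∈ Finsupp.supported ℝ ℝ {w : List Bool | w.length = k}) (β : Bool) :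
    consMap β x ∈ Finsupp.supported ℝ ℝ {w : List Bool | w.length = k + 1} := by
  have h1 := Finsupp.lmapDomain_supported (M := ℝ) (R := ℝ) (List.cons β)
    {w : List Bool | w.length = k}
  have h2 : consMap β x ∈ (Finsupp.supported ℝ ℝ {w : List Bool | w.length = k}).map
      (Finsupp.lmapDomain ℝ ℝ (List.cons β)) := Submodule.mem_map_of_mem hx
  rw [h1] at h2
  refine Finsupp.supported_mono ?_ h2
  rintro _ ⟨w, hw, rfl⟩
  simpa using hw

lemma pow_mem_supported {Y : Module.End ℝ (List Bool →₀ ℝ)}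
    (hY : ∀ k, ∀ x ∈ Finsupp.supported ℝ ℝ {w : List Bool | w.length = k},
      Y x ∈ Finsupp.supported ℝ ℝ {w : List Bool | w.length = k + 1})
    (i : ℕ) {k : ℕ} {x : List Bool →₀ ℝ}
    (hx : x ∈ Finsupp.supported ℝ ℝ {w : List Bool | w.length = k}) :
    (Y ^ i) x ∈ Finsupp.supported ℝ ℝ {w : List Bool | w.length = k + i} := by
  induction i with
  | zero => simpa using hx
  | succ i ih => rw [pow_succ', Module.End.mul_apply]; exact hY _ _ ih

lemma single_nil_mem_supported :
    Finsupp.single ([] : List Bool) (1 : ℝ) ∈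
      Finsupp.supported ℝ ℝ {w : List Bool | w.length = 0} :=
  Finsupp.single_mem_supported ℝ _ rfl

/-- The `m`-th coefficient is homogeneous of degree `m`. -/
lemma formalCoeff_consMap_mem_supported (l : List (ℝ × Bool)) (m : ℕ) :
    formalCoeff consMap l (Finsupp.single [] 1) m ∈
      Finsupp.supported ℝ ℝ {w : List Bool | w.length = m} := by
  induction l generalizing m with
  | nil =>
    rw [formalCoeff]
    split_ifs with h
    · subst h; exact single_nil_mem_supported
    · exact Submodule.zero_mem _
  | cons y l ih =>
    obtain ⟨x, β⟩ := y
    refine Submodule.sum_mem _ fun j hj => Submodule.smul_mem _ _ ?_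
    have := pow_mem_supported (Y := consMap β) (fun k x hx => consMap_mem_supported hx β)
      (m - j) (ih j)
    rwa [Nat.add_sub_of_le (Finset.mem_range_succ_iff.1 hj)] at this

lemma wordMap_consMap {M : Type*} [AddCommGroup M] [Module ℝ M] (X : Bool → Module.End ℝ M) (f : M)
    (β : Bool) (x : List Bool →₀ ℝ) : wordMap X f (consMap β x) = X β (wordMap X f x) := by
  induction x using Finsupp.induction_linear with
  | zero => simp
  | add x y hx hy => simp only [map_add, hx, hy]
  | single w c => simp [consMap, wordMap]

lemma wordMap_single_nil {M : Type*} [AddCommGroup M] [Module ℝ M] (X : Bool → Module.End ℝ M)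
    (f : M) : wordMap X f (Finsupp.single [] 1) = f := by
  simp [wordMap]

/-- The action of the two letters on words of length at most `n`, longer words being zero, is a
finite-dimensional representation in which words of length at most `n` are linearly independent. -/
lemma exists_truncated_word_representation (n : ℕ) :
    ∃ (d : ℕ) (X : Bool → EuclideanSpace ℂ (Fin d) →L[ℂ] EuclideanSpace ℂ (Fin d))
      (π : (List Bool →₀ ℝ) →ₗ[ℝ] EuclideanSpace ℂ (Fin d)),
      (∀ β x, π (consMap β x) = X β (π x)) ∧
      ∀ m ≤ n, ∀ x ∈ Finsupp.supported ℝ ℝ {w : List Bool | w.length = m}, π x = 0 → x = 0 := by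
  classical
  have : Finite {w : List Bool // w.length ≤ n} := (List.finite_length_le Bool n).to_subtype
  obtain ⟨d, ⟨e⟩⟩ := Finite.exists_equiv_fin {w : List Bool // w.length ≤ n}
  let vec : List Bool → EuclideanSpace ℂ (Fin d) := fun w =>
    if h : w.length ≤ n then EuclideanSpace.single (e ⟨w, h⟩) 1 else 0
  let X : Bool → EuclideanSpace ℂ (Fin d) →L[ℂ] EuclideanSpace ℂ (Fin d) := fun β =>
    LinearMap.toContinuousLinearMap
      (∑ i : Fin d, (EuclideanSpace.proj i : EuclideanSpace ℂ (Fin d) →L[ℂ] ℂ).toLinearMap.smulRight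
        (vec (β :: (e.symm i).1)))
  have hX : ∀ β w, X β (vec w) = vec (β :: w) := by
    intro β w
    by_cases h : w.length ≤ n
    · simp only [X, LinearMap.coe_toContinuousLinearMap', LinearMap.sum_apply]
      rw [Finset.sum_eq_single (e ⟨w, h⟩)]
      · simp [vec, h]
      · intro i _ hi
        simp [vec, h, hi]
      · simp
    · have h' : ¬ (β :: w).length ≤ n := by simp only [List.length_cons]; omega
      simp only [vec, h, h', dite_false, map_zero]
  refine ⟨d, X, Finsupp.linearCombination ℝ vec, fun β x => ?_, fun m hm x hx h0 => ?_⟩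
  · induction x using Finsupp.induction_linear with
    | zero => simp
    | add x y hx hy => simp only [map_add, hx, hy]
    | single w c =>
      simp only [consMap, Finsupp.lmapDomain_apply, Finsupp.mapDomain_single,
        Finsupp.linearCombination_single]
      rw [← hX, ContinuousLinearMap.map_smul_of_tower]
  · have hcoord : ∀ (y : List Bool →₀ ℝ) (w : {w : List Bool // w.length ≤ n}),
        (Finsupp.linearCombination ℝ vec y) (e w) = (y w.1 : ℂ) := by
      intro y w
      induction y using Finsupp.induction_linear with
      | zero => simp
      | add x y hx hy => simp [hx, hy]
      | single w' c =>
        simp only [Finsupp.linearCombination_single, vec]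
        by_cases h : w'.length ≤ n
        · by_cases h' : w' = w.1
          · simp [h', w.2]
          · simp [h, e.injective.eq_iff, Subtype.ext_iff, Ne.symm h']
        · have : w' ≠ w.1 := fun h' => h (h' ▸ w.2)
          simp [h, this]
    ext w
    by_cases hw : w.length = m
    · have := hcoord x ⟨w, hw.le.trans hm⟩
      rw [h0] at this
      simpa using this.symm
    · by_contra hne
      exact hw ((Finsupp.mem_supported _ _).1 hx (Finsupp.mem_support_iff.2 hne))

/-- A product formula of order `n` for matrices agrees with the exponential up to order `n` as a
formal power series, for any two linear operators on any real vector space. -/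
theorem IsProductFormula.formalCoeff_eq {n q : ℕ} {a b : ℕ → ℝ} (hab : IsProductFormula n q a b)
    {M : Type*} [AddCommGroup M] [Module ℝ M] (X : Bool → Module.End ℝ M) (f : M)
    {m : ℕ} (hm : m ≤ n) :
    formalCoeff X ((a 0, false) :: cycleFactors a b q 0) f m =
      ((m.factorial : ℝ)⁻¹) • ((X false + X true) ^ m) f := by
  set l := (a 0, false) :: cycleFactors a b q 0 with hl
  have hfree : formalCoeff consMap l (Finsupp.single [] 1) m =
      ((m.factorial : ℝ)⁻¹) • ((consMap false + consMap true) ^ m) (Finsupp.single [] 1) := by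
    obtain ⟨d, Y, π, hπ, hinj⟩ := exists_truncated_word_representation n
    refine sub_eq_zero.1 (hinj m hm _ (Submodule.sub_mem _
      (formalCoeff_consMap_mem_supported l m) (Submodule.smul_mem _ _ ?_)) ?_)
    · have := pow_mem_supported (Y := consMap false + consMap true) (fun k x hx =>
        Submodule.add_mem _ (consMap_mem_supported hx _) (consMap_mem_supported hx _))
        m single_nil_mem_supported
      rwa [zero_add] at this
    · let Y' : Bool → Module.End ℝ (EuclideanSpace ℂ (Fin d)) := fun β =>
        (Y β).toLinearMap.restrictScalars ℝ
      let v := π (Finsupp.single [] 1)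
      let ev : (EuclideanSpace ℂ (Fin d) →L[ℂ] EuclideanSpace ℂ (Fin d)) →ₗ[ℝ]
          EuclideanSpace ℂ (Fin d) :=
        { toFun := fun Z => Z v, map_add' := fun _ _ => rfl, map_smul' := fun _ _ => rfl }
      have h1 : π (formalCoeff consMap l (Finsupp.single [] 1) m) = formalCoeff Y' l v m :=
        map_formalCoeff π hπ l _ m
      have h2 := map_formalCoeff (X := fun β => LinearMap.mulLeft ℝ (Y β)) (Y := Y') ev
        (fun β Z => rfl) l 1 m
      rw [hab.formalCoeff_operator Y hm] at h2
      have h3 : π (((consMap false + consMap true) ^ m) (Finsupp.single [] 1)) =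
          ((Y' false + Y' true) ^ m) v :=
        map_pow_apply π (fun x => by simp only [LinearMap.add_apply, map_add, hπ]; rfl) m _
      have h4 : ev ((Y false + Y true) ^ m) = ((Y' false + Y' true) ^ m) v := by
        have := map_pow_apply (X := LinearMap.mulLeft ℝ (Y false + Y true)) (Y := Y' false + Y' true)
          ev (fun Z => rfl) m 1
        rwa [LinearMap.pow_mulLeft, LinearMap.mulLeft_apply, mul_one] at this
      rw [map_sub, map_smul, h1, h3, ← h4, ← map_smul, h2]
      exact sub_self _
  have := congrArg (wordMap X f) hfree
  rwa [map_formalCoeff _ (wordMap_consMap X f), map_smul, wordMap_single_nil,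
    map_pow_apply (Y := X false + X true) _ (fun x => by
      simp only [LinearMap.add_apply, map_add, wordMap_consMap]), wordMap_single_nil] at this

end Words

/-- A product formula of order at least one is consistent; this is its first order condition for the
operators `A = 0` and `B = 1` on `ℝ`. -/
lemma IsProductFormula.sum_b_eq_one {n q : ℕ} {a b : ℕ → ℝ} (hab : IsProductFormula n q a b)
    (hn : 1 ≤ n) : ∑ j ∈ Finset.range q, b j = 1 := by
  have h := hab.formalCoeff_eq (M := ℝ) (fun β => if β then 1 else 0) 1 hn
  rw [formalCoeff_one] at h
  have key : ∀ r j, ((cycleFactors a b r j).map fun y =>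
      y.1 • (if y.2 then (1 : Module.End ℝ ℝ) else 0) 1).sum = ∑ i ∈ Finset.Ico j (j + r), b i := by
    intro r
    induction r with
    | zero => simp [cycleFactors]
    | succ r ih =>
      intro j
      rw [Finset.sum_eq_sum_Ico_succ_bot (by omega), show j + (r + 1) = j + 1 + r by omega, ← ih]
      simp [cycleFactors]
  rw [List.map_cons, List.sum_cons, key] at h
  simpa using h

/-! ### Merging neighbouring gates -/

section Merge

variable {G : Type*} {join : G → G → Option G}

/-- Merging preserves the product of the gates if every single merger does. -/
lemma prod_map_mergeGates {R : Type*} [Monoid R] (op : G → R)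
    (hop : ∀ g g' h, join g g' = some h → op h = op g * op g') (l : List G) :
    ((mergeGates join l).map op).prod = (l.map op).prod := by
  induction l with
  | nil => rfl
  | cons g l ih =>
    rw [List.map_cons, List.prod_cons, ← ih, mergeGates]
    cases h1 : mergeGates join l with
    | nil => rfl
    | cons g' l' =>
      cases h2 : join g g' with
      | none => simp [h2]
      | some h => simp [h2, hop g g' h h2, mul_assoc]

/-- Merging keeps the left end of the first gate, so it does not change what can be joined to it. -/
lemma mergeGates_cons (hkey : ∀ g g' h, join g g' = some h →
    ∀ k, (join k h).isSome = (join k g).isSome) (g : G) (l : List G) :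
    ∃ h t, mergeGates join (g :: l) = h :: t ∧ ∀ k, (join k h).isSome = (join k g).isSome := by
  rw [mergeGates]
  cases h1 : mergeGates join l with
  | nil => exact ⟨g, [], rfl, fun _ => rfl⟩
  | cons g' l' =>
    cases h2 : join g g' with
    | none => exact ⟨g, g' :: l', by simp [h2], fun _ => rfl⟩
    | some h => exact ⟨h, l', by simp [h2], hkey g g' h h2⟩

lemma length_mergeGates_cons_cons (hkey : ∀ g g' h, join g g' = some h →
    ∀ k, (join k h).isSome = (join k g).isSome) (g g' : G) (l : List G) :
    (mergeGates join (g :: g' :: l)).length =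
      (mergeGates join (g' :: l)).length + if (join g g').isSome then 0 else 1 := by
  obtain ⟨h, t, h1, h2⟩ := mergeGates_cons hkey g' l
  rw [mergeGates, h1, ← h2 g]
  cases h3 : join g h <;> simp [h3]

lemma length_mergeGates_of_isChain (hkey : ∀ g g' h, join g g' = some h →
    ∀ k, (join k h).isSome = (join k g).isSome) {l : List G}
    (hl : l.IsChain fun g g' => (join g g').isSome = false) :
    (mergeGates join l).length = l.length := by
  induction l with
  | nil => rfl
  | cons g l ih =>
    cases l with
    | nil => rfl
    | cons g' l =>
      rw [List.isChain_cons_cons] at hl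
      rw [length_mergeGates_cons_cons hkey, ih hl.2, hl.1]
      simp

/-- If no two neighbours in `l₁` can be joined, but its last gate can be joined to the first gate
of `l₂`, exactly one gate disappears at the junction. -/
lemma length_mergeGates_append (hkey : ∀ g g' h, join g g' = some h →
    ∀ k, (join k h).isSome = (join k g).isSome) {l₁ l₂ : List G}
    (hl : l₁.IsChain fun g g' => (join g g').isSome = false) {x y : G}
    (hx : l₁.getLast? = some x) (hy : l₂.head? = some y) (hxy : (join x y).isSome = true) :
    (mergeGates join (l₁ ++ l₂)).length + 1 = l₁.length + (mergeGates join l₂).length := by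
  induction l₁ with
  | nil => simp at hx
  | cons g l ih =>
    cases l with
    | nil =>
      obtain ⟨t, rfl⟩ : ∃ t, l₂ = y :: t := by
        cases l₂ with
        | nil => simp at hy
        | cons z t => exact ⟨t, by simpa using hy⟩
      obtain rfl : g = x := by simpa using hx
      rw [List.singleton_append, length_mergeGates_cons_cons hkey, hxy]
      simp [add_comm]
    | cons g' l =>
      rw [List.isChain_cons_cons] at hl
      have := ih hl.2 (by simpa using hx)
      rw [List.cons_append] at this
      rw [List.cons_append, List.cons_append, length_mergeGates_cons_cons hkey, hl.1]
      simp only [List.length_cons, Bool.false_eq_true, if_false] at this ⊢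
      omega

/-- The gate count of `q ≥ 1` cycles, each one a forward and a backward sweep over `Λ` indices, when
two neighbouring gates can be joined exactly if they have the same index. -/
theorem length_mergeGates_sweeps (hkey : ∀ g g' h, join g g' = some h →
    ∀ k, (join k h).isSome = (join k g).isSome) {Λ : ℕ} (hΛ : 1 ≤ Λ) (f b : ℕ → Fin Λ → G)
    (hff : ∀ j i i', i ≠ i' → (join (f j i) (f j i')).isSome = false)
    (hbb : ∀ j i i', i ≠ i' → (join (b j i) (b j i')).isSome = false)
    (hfb : ∀ j i, (join (f j i) (b j i)).isSome = true)
    (hbf : ∀ j i, (join (b j i) (f (j + 1) i)).isSome = true) {q : ℕ} (hq : 1 ≤ q) :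
    (mergeGates join ((List.range q).flatMap fun j =>
      (List.finRange Λ).map (f j) ++ (List.finRange Λ).reverse.map (b j))).length =
      2 * Λ * q - (2 * q - 1) := by
  obtain ⟨Λ, rfl⟩ : ∃ Λ', Λ = Λ' + 1 := ⟨Λ - 1, by omega⟩
  obtain ⟨q, rfl⟩ : ∃ q', q = q' + 1 := ⟨q - 1, by omega⟩
  have hcf : ∀ j, ((List.finRange (Λ + 1)).map (f j)).IsChain
      fun g g' => (join g g').isSome = false := fun j =>
    ((List.pairwise_map.2 ((List.nodup_finRange _).imp fun h => hff j _ _ h))).isChain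
  have hcb : ∀ j, ((List.finRange (Λ + 1)).reverse.map (b j)).IsChain
      fun g g' => (join g g').isSome = false := fun j =>
    ((List.pairwise_map.2 ((List.nodup_reverse.2 (List.nodup_finRange _)).imp
      fun h => hbb j _ _ h))).isChain
  have hlast : (List.finRange (Λ + 1)).getLast? = some (Fin.last Λ) := by
    simp [List.finRange_succ_last]
  have hhead : (List.finRange (Λ + 1)).head? = some 0 := by simp [List.finRange_succ]
  have key : ∀ r j, (mergeGates join ((List.range' j (r + 1)).flatMap fun j =>
      (List.finRange (Λ + 1)).map (f j) ++ (List.finRange (Λ + 1)).reverse.map (b j))).length =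
      2 * Λ * (r + 1) + 1 := by
    intro r
    induction r with
    | zero =>
      intro j
      have h1 := length_mergeGates_append hkey (hcf j) (x := f j (Fin.last Λ))
        (y := b j (Fin.last Λ)) (l₂ := (List.finRange (Λ + 1)).reverse.map (b j))
        (by simp [hlast]) (by simp [hlast]) (hfb j _)
      rw [length_mergeGates_of_isChain hkey (hcb j)] at h1
      simp only [List.length_map, List.length_reverse, List.length_finRange] at h1
      simp only [zero_add, List.range'_one, List.flatMap_singleton]
      omega
    | succ r ih =>
      intro j
      have hrest := ih (j + 1)
      rw [List.range'_succ, List.flatMap_cons, List.append_assoc]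
      set rest := (List.range' (j + 1) (r + 1)).flatMap fun j =>
        (List.finRange (Λ + 1)).map (f j) ++ (List.finRange (Λ + 1)).reverse.map (b j) with hr
      have hresthead : rest.head? = some (f (j + 1) 0) := by
        rw [hr, List.range'_succ, List.flatMap_cons, List.append_assoc, List.head?_append]
        simp [hhead]
      have h2 := length_mergeGates_append hkey (hcb j) (x := b j 0) (l₂ := rest)
        (by simp [hhead]) hresthead (hbf j _)
      have h1 := length_mergeGates_append hkey (hcf j) (x := f j (Fin.last Λ))
        (y := b j (Fin.last Λ)) (l₂ := (List.finRange (Λ + 1)).reverse.map (b j) ++ rest)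
        (by simp [hlast]) (by simp [hlast]) (hfb j _)
      simp only [List.length_map, List.length_reverse, List.length_finRange] at h1 h2
      have : 2 * Λ * (r + 1 + 1) = 2 * Λ * (r + 1) + 2 * Λ := by ring
      omega
  rw [List.range_eq_range', key q 0]
  have : 2 * (Λ + 1) * (q + 1) = 2 * Λ * (q + 1) + 2 * (q + 1) := by ring
  omega

lemma prod_map_flatMap {R ι : Type*} [Monoid R] (op : G → R) (l : List ι) (F : ι → List G) :
    ((l.flatMap F).map op).prod = (l.map fun i => ((F i).map op).prod).prod := by
  induction l with
  | nil => rfl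
  | cons i l ih => simp [ih]

end Merge

lemma EvolutionGate.isSome_join {Λ : ℕ} (g g' : EvolutionGate Λ) :
    (EvolutionGate.join g g').isSome ↔ g.idx = g'.idx ∧ g.init = g'.final := by
  rw [EvolutionGate.join]; split_ifs with h <;> simp [h]

lemma EvolutionGate.eq_of_join_eq_some {Λ : ℕ} {g g' h : EvolutionGate Λ}
    (hj : EvolutionGate.join g g' = some h) :
    g.idx = g'.idx ∧ g.init = g'.final ∧ h = ⟨g.idx, g.final, g'.init⟩ := by
  rw [EvolutionGate.join] at hj
  split_ifs at hj with hc
  exact ⟨hc.1, hc.2, (Option.some.inj hj).symm⟩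

lemma ExpGate.isSome_join {Λ : ℕ} (g g' : ExpGate Λ) :
    (ExpGate.join g g').isSome ↔ g.idx = g'.idx := by
  rw [ExpGate.join]; split_ifs with h <;> simp [h]

lemma ExpGate.eq_of_join_eq_some {Λ : ℕ} {g g' h : ExpGate Λ}
    (hj : ExpGate.join g g' = some h) :
    g.idx = g'.idx ∧ h = ⟨g.idx, g.duration + g'.duration⟩ := by
  rw [ExpGate.join] at hj
  split_ifs at hj with hc
  exact ⟨hc, (Option.some.inj hj).symm⟩

theorem length_hdrCircuit {Λ q : ℕ} (hΛ : 1 ≤ Λ) (hq : 1 ≤ q) (a b : ℕ → ℝ) (t Δt : ℝ) :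
    (hdrCircuit Λ q a b t Δt).length = 2 * Λ * q - (2 * q - 1) := by
  refine length_mergeGates_sweeps (join := EvolutionGate.join (Λ := Λ)) (fun g g' h hj k => ?_) hΛ
    (fun j i => ⟨i, t + breakL q a b Δt j, t + breakR q a b Δt j⟩)
    (fun j i => ⟨i, t + breakR q a b Δt j, t + breakL q a b Δt (j + 1)⟩) ?_ ?_ ?_ ?_ hq
  · obtain ⟨-, -, rfl⟩ := EvolutionGate.eq_of_join_eq_some hj
    rw [Bool.eq_iff_iff, EvolutionGate.isSome_join, EvolutionGate.isSome_join]
  · intro j i i' h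
    rw [Bool.eq_false_iff, Ne, EvolutionGate.isSome_join]
    exact fun h' => h h'.1
  · intro j i i' h
    rw [Bool.eq_false_iff, Ne, EvolutionGate.isSome_join]
    exact fun h' => h h'.1
  · intro j i
    rw [EvolutionGate.isSome_join]
    exact ⟨rfl, rfl⟩
  · intro j i
    rw [EvolutionGate.isSome_join]
    exact ⟨rfl, rfl⟩

theorem length_timeIndependentCircuit {Λ q : ℕ} (hΛ : 1 ≤ Λ) (hq : 1 ≤ q) (a b : ℕ → ℝ) (τ : ℝ) :
    (timeIndependentCircuit Λ q a b τ).length = 2 * Λ * q - (2 * q - 1) := by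
  refine length_mergeGates_sweeps (join := ExpGate.join (Λ := Λ)) (fun g g' h hj k => ?_) hΛ
    (fun j i => ⟨i, weightC a b j * τ⟩) (fun j i => ⟨i, weightD a b j * τ⟩) ?_ ?_ ?_ ?_ hq
  · obtain ⟨-, rfl⟩ := ExpGate.eq_of_join_eq_some hj
    rw [Bool.eq_iff_iff, ExpGate.isSome_join, ExpGate.isSome_join]
  · intro j i i' h
    rw [Bool.eq_false_iff, Ne, ExpGate.isSome_join]
    exact h
  · intro j i i' h
    rw [Bool.eq_false_iff, Ne, ExpGate.isSome_join]
    exact h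
  · intro j i
    rw [ExpGate.isSome_join]
  · intro j i
    rw [ExpGate.isSome_join]

theorem evolutionCircuitOp_hdrCircuit {E : Type*} [NormedAddCommGroup E] [InnerProductSpace ℂ E]
    [CompleteSpace E] {Λ : ℕ} (q : ℕ) (a b : ℕ → ℝ) {H : Fin Λ → ℝ → E →L[ℂ] E}
    (hH : ∀ k, Continuous (H k)) (t Δt : ℝ) :
    evolutionCircuitOp H (hdrCircuit Λ q a b t Δt) = hdrStep q a b H t Δt := by
  rw [evolutionCircuitOp, hdrCircuit, prod_map_mergeGates, prod_map_flatMap, hdrStep]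
  · simp only [List.map_append, List.prod_append, List.map_map]
    rfl
  · intro g g' h hj
    obtain ⟨h1, h2, rfl⟩ := EvolutionGate.eq_of_join_eq_some hj
    dsimp only
    rw [← h1, ← h2, timeOrderedExp_mul (hH _)]

theorem expCircuitOp_timeIndependentCircuit {E : Type*} [NormedAddCommGroup E]
    [InnerProductSpace ℂ E] [CompleteSpace E] {Λ : ℕ} (q : ℕ) (a b : ℕ → ℝ)
    (A : Fin Λ → E →L[ℂ] E) (τ : ℝ) :
    expCircuitOp A (timeIndependentCircuit Λ q a b τ) = multiOperatorProduct q a b A τ := by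
  rw [expCircuitOp, timeIndependentCircuit, prod_map_mergeGates, prod_map_flatMap,
    multiOperatorProduct]
  · simp only [List.map_append, List.prod_append, List.map_map]
    rfl
  · intro g g' h hj
    obtain ⟨h1, rfl⟩ := ExpGate.eq_of_join_eq_some hj
    dsimp only
    let _ : NormedAlgebra ℚ (E →L[ℂ] E) := .restrictScalars ℚ ℝ _
    rw [← h1, add_smul, NormedSpace.exp_add_of_commute]
    exact ((Commute.refl _).smul_left _).smul_right _

/-! ### Sweeps -/

section Sweeps

variable {E : Type*} [NormedAddCommGroup E] [InnerProductSpace ℂ E] [CompleteSpace E] {Λ : ℕ}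
  {H : Fin Λ → ℝ → E →L[ℂ] E}

lemma prod_timeOrderedExp_mul_reverse (hH : ∀ k, Continuous (H k)) (l : List (Fin Λ)) (t s : ℝ) :
    (l.map fun k => timeOrderedExp (H k) t s).prod *
      (l.reverse.map fun k => timeOrderedExp (H k) s t).prod = 1 := by
  induction l with
  | nil => simp
  | cons k l ih =>
    rw [List.reverse_cons, List.map_append, List.prod_append, List.map_cons, List.prod_cons,
      mul_assoc, ← mul_assoc _ _ (List.prod _), ih, one_mul]
    simpa using timeOrderedExp_mul_swap (hH k) t s

/-- The backward sweep is the adjoint method of the forward sweep: `U_F(t, s) = U_B(s, t)⁻¹`. -/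
lemma forwardSweep_mul_backwardSweep (hH : ∀ k, Continuous (H k)) (t s : ℝ) :
    forwardSweep H t s * backwardSweep H s t = 1 :=
  prod_timeOrderedExp_mul_reverse hH _ t s

lemma backwardSweep_mul_forwardSweep (hH : ∀ k, Continuous (H k)) (t s : ℝ) :
    backwardSweep H t s * forwardSweep H s t = 1 := by
  simpa [backwardSweep, forwardSweep] using
    prod_timeOrderedExp_mul_reverse hH (List.finRange Λ).reverse t s

lemma contDiff_prod_timeOrderedExp (hH : ∀ k, ContDiff ℝ ∞ (H k)) (l : List (Fin Λ)) :
    ContDiff ℝ ∞ fun p : ℝ × ℝ => (l.map fun k => timeOrderedExp (H k) p.1 p.2).prod := by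
  induction l with
  | nil => exact contDiff_const
  | cons k l ih =>
    simp only [List.map_cons, List.prod_cons]
    exact (contDiff_timeOrderedExp (hH k)).mul ih

lemma hasDerivAt_timeOrderedExp_sub {G : ℝ → E →L[ℂ] E} (hG : ContDiff ℝ ∞ G) (t : ℝ) :
    HasDerivAt (fun h => timeOrderedExp G t (t - h)) ((-Complex.I) • G t) 0 := by
  have h1 : HasDerivAt (fun s => timeOrderedExp G t s) (Complex.I • G t) (t - 0) := by
    simpa using hasDerivAt_timeOrderedExp_right_self hG t
  have h2 := h1.scomp (0 : ℝ) ((hasDerivAt_id (0 : ℝ)).const_sub t)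
  rw [neg_one_smul, ← neg_smul] at h2
  exact h2

/-- The backward sweep is consistent: to first order it is generated by `-i ∑ H_k`. -/
lemma hasDerivAt_backwardSweep_sub (hH : ∀ k, ContDiff ℝ ∞ (H k)) (t : ℝ) :
    HasDerivAt (fun h => backwardSweep H t (t - h)) ((-Complex.I) • ∑ k, H k t) 0 := by
  have key : ∀ l : List (Fin Λ),
      HasDerivAt (fun h => (l.map fun k => timeOrderedExp (H k) t (t - h)).prod)
        ((-Complex.I) • (l.map fun k => H k t).sum) 0 := by
    intro l
    induction l with
    | nil => simpa using hasDerivAt_const (0 : ℝ) (1 : E →L[ℂ] E)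
    | cons k l ih =>
      have h1 := (hasDerivAt_timeOrderedExp_sub (hH k) t).mul ih
      have h2 : (l.map fun k => timeOrderedExp (H k) t (t - 0)).prod = 1 := by
        simp
      rw [h2, sub_zero, timeOrderedExp_self, one_mul, mul_one, ← smul_add] at h1
      simpa using! h1
  have := key (List.finRange Λ).reverse
  rwa [List.map_reverse, List.sum_reverse, ← List.ofFn_eq_map, List.sum_ofFn] at this

end Sweeps

/-! ### The scheme as a product of transport flows -/

section Generators

variable {P 𝔸 : Type*} [NormedAddCommGroup P] [NormedSpace ℝ P] [NormedRing 𝔸] [NormedAlgebra ℝ 𝔸]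

/-- A transport generator is the directional derivative plus multiplication by the logarithmic
derivative of the conjugating function. -/
lemma transportGenerator_eq {v : P} {Z Zi : smoothFun P 𝔸} (hZ : ∀ p, Z.1 p * Zi.1 p = 1)
    (hZ' : ∀ p, Zi.1 p * Z.1 p = 1) {p : P} {D : 𝔸}
    (hD : HasDerivAt (fun h : ℝ => Zi.1 p * Z.1 (p + h • v)) D 0) (f : smoothFun P 𝔸) :
    (transportGenerator v Z Zi f).1 p = fderiv ℝ f.1 p v + D * f.1 p := by
  have h1 := hasDerivAt_transport (v := v) hZ f p 0
  have hline : HasDerivAt (fun h : ℝ => p + h • v) v 0 := by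
    simpa using ((hasDerivAt_id (0 : ℝ)).smul_const v).const_add p
  have h2 := (differentiable_smoothFun f (p + (0 : ℝ) • v)).hasFDerivAt.comp_hasDerivAt 0 hline
  have h3 := hD.mul h2
  have h4 : (fun h : ℝ => Zi.1 p * Z.1 (p + h • v)) * (f.1 ∘ fun h : ℝ => p + h • v)
      = fun h => (transport v Z Zi h f).1 p := by
    ext1 h
    simp [mul_assoc]
  rw [h4] at h3
  have h5 := h1.unique h3
  rw [transport_apply, ← mul_assoc, zero_smul, add_zero, hZ', one_mul] at h5
  rw [h5]
  simp [add_comm]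

end Generators

section Flows

variable {E : Type*} [NormedAddCommGroup E] [InnerProductSpace ℂ E] [CompleteSpace E] {Λ : ℕ}
  {H : Fin Λ → ℝ → E →L[ℂ] E}

/-- The constant function `1`. -/
def oneFun (E : Type*) [NormedAddCommGroup E] [InnerProductSpace ℂ E] :
    smoothFun (ℝ × ℝ) (E →L[ℂ] E) := 
  ⟨fun _ => 1, (contDiff_const : ContDiff ℝ ∞ fun _ : ℝ × ℝ => (1 : E →L[ℂ] E))⟩

/-- The conjugating function `(t, s) ↦ U_B(t + s, t)`. -/
def backwardFun (hH : ∀ k, ContDiff ℝ ∞ (H k)) : smoothFun (ℝ × ℝ) (E →L[ℂ] E) :=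
  ⟨fun p => backwardSweep H (p.1 + p.2) p.1,
    (contDiff_prod_timeOrderedExp hH (List.finRange Λ).reverse).comp
      ((contDiff_fst.add contDiff_snd).prodMk contDiff_fst)⟩

/-- The pointwise inverse `(t, s) ↦ U_F(t, t + s)` of `backwardFun`. -/
def forwardFun (hH : ∀ k, ContDiff ℝ ∞ (H k)) : smoothFun (ℝ × ℝ) (E →L[ℂ] E) :=
  ⟨fun p => forwardSweep H p.1 (p.1 + p.2),
    (contDiff_prod_timeOrderedExp hH (List.finRange Λ)).comp
      (contDiff_fst.prodMk (contDiff_fst.add contDiff_snd))⟩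

/-- The function `(t, s) ↦ U(0, t)` for the generator `G`. -/
def initialFun {G : ℝ → E →L[ℂ] E} (hG : ContDiff ℝ ∞ G) : smoothFun (ℝ × ℝ) (E →L[ℂ] E) :=
  ⟨fun p => timeOrderedExp G 0 p.1, (contDiff_timeOrderedExp_right hG 0).comp contDiff_fst⟩

/-- The function `(t, s) ↦ U(t, 0)` for the generator `G`. -/
def finalFun {G : ℝ → E →L[ℂ] E} (hG : ContDiff ℝ ∞ G) : smoothFun (ℝ × ℝ) (E →L[ℂ] E) :=
  ⟨fun p => timeOrderedExp G p.1 0, (contDiff_timeOrderedExp_left hG 0).comp contDiff_fst⟩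

/-- The flows `e^{hA}` (index `false`) and `e^{hB}` (index `true`) on functions of `(t, s)`:
`e^{hA}` translates the auxiliary variable `s` by `-h`, and `e^{hB}` translates `(t, s)` by
`(-h, h)`, conjugated by `U_B(t + s, t)`. -/
def splitFlow (hH : ∀ k, ContDiff ℝ ∞ (H k)) : Bool → ℝ →
    smoothFun (ℝ × ℝ) (E →L[ℂ] E) →ₗ[ℝ] smoothFun (ℝ × ℝ) (E →L[ℂ] E)
  | false => transport (0, -1) (oneFun E) (oneFun E)
  | true => transport (-1, 1) (backwardFun hH) (forwardFun hH)

/-- The generators `A` and `B` of `splitFlow`. -/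
def splitGenerator (hH : ∀ k, ContDiff ℝ ∞ (H k)) :
    Bool → Module.End ℝ (smoothFun (ℝ × ℝ) (E →L[ℂ] E))
  | false => transportGenerator (0, -1) (oneFun E) (oneFun E)
  | true => transportGenerator (-1, 1) (backwardFun hH) (forwardFun hH)

lemma isFlow_splitFlow (hH : ∀ k, ContDiff ℝ ∞ (H k)) (β : Bool) :
    (smoothScale (ℝ × ℝ) (E →L[ℂ] E)).IsFlow (splitFlow hH β) (splitGenerator hH β) := by
  cases β
  · exact isFlow_transport (fun _ => one_mul 1) (fun _ => one_mul 1)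
  · exact isFlow_transport
      (fun p => backwardSweep_mul_forwardSweep (fun k => (hH k).continuous) (p.1 + p.2) p.1)
      (fun p => forwardSweep_mul_backwardSweep (fun k => (hH k).continuous) p.1 (p.1 + p.2))

/-- On the line `s = 0`, the sum `A + B` is the generator of the exact evolution: the translations
add up to that of `t`, and the sweep contributes its first-order term `-i ∑ H_k`. -/
lemma splitGenerator_add_apply (hH : ∀ k, ContDiff ℝ ∞ (H k))
    (hG : ContDiff ℝ ∞ fun s => ∑ k, H k s) (f : smoothFun (ℝ × ℝ) (E →L[ℂ] E)) (t : ℝ) :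
    ((splitGenerator hH false + splitGenerator hH true) f).1 (t, 0) =
      (transportGenerator (-1, 0) (initialFun hG) (finalFun hG) f).1 (t, 0) := by
  have hc : ∀ k, Continuous (H k) := fun k => (hH k).continuous
  have hA := transportGenerator_eq (v := ((0, -1) : ℝ × ℝ)) (Z := oneFun E) (Zi := oneFun E)
    (fun _ => one_mul 1) (fun _ => one_mul 1) (p := (t, 0)) (D := 0)
    (by simpa [oneFun] using hasDerivAt_const (0 : ℝ) (1 : E →L[ℂ] E)) f
  have hB := transportGenerator_eq (v := ((-1, 1) : ℝ × ℝ)) (Z := backwardFun hH)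
    (Zi := forwardFun hH) (p := (t, 0)) (D := (-Complex.I) • ∑ k, H k t)
    (fun p => backwardSweep_mul_forwardSweep hc (p.1 + p.2) p.1)
    (fun p => forwardSweep_mul_backwardSweep hc p.1 (p.1 + p.2)) (by
      have h1 : forwardSweep H t t = 1 := by simp [forwardSweep]
      simpa [forwardFun, backwardFun, h1, ← sub_eq_add_neg] using hasDerivAt_backwardSweep_sub hH t) f
  have hC := transportGenerator_eq (v := ((-1, 0) : ℝ × ℝ)) (Z := initialFun hG)
    (Zi := finalFun hG) (p := (t, 0)) (D := (-Complex.I) • ∑ k, H k t)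
    (fun p => timeOrderedExp_mul_swap hG.continuous 0 p.1)
    (fun p => timeOrderedExp_mul_swap hG.continuous p.1 0) (by
      simpa [finalFun, initialFun, timeOrderedExp_mul hG.continuous, ← sub_eq_add_neg] using
        hasDerivAt_timeOrderedExp_sub hG t) f
  have hv : ((-1, 0) : ℝ × ℝ) = (0, -1) + (-1, 1) := by simp
  rw [hC, hv, map_add, add_assoc, ← hB]
  have : (splitGenerator hH false f).1 (t, 0) = fderiv ℝ f.1 (t, 0) (0, -1) := by
    rw [zero_mul, add_zero] at hA
    exact hA
  rw [← this]
  rfl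

/-- The generator of the exact evolution acts along the line `s = 0`. -/
lemma transportGenerator_congr_line {Z Zi : smoothFun (ℝ × ℝ) (E →L[ℂ] E)}
    (hZ : ∀ p, Z.1 p * Zi.1 p = 1) (hZ' : ∀ p, Zi.1 p * Z.1 p = 1)
    {f g : smoothFun (ℝ × ℝ) (E →L[ℂ] E)} (hfg : ∀ t : ℝ, f.1 (t, 0) = g.1 (t, 0)) (t : ℝ) :
    (transportGenerator (-1, 0) Z Zi f).1 (t, 0) = (transportGenerator (-1, 0) Z Zi g).1 (t, 0) := by
  have h1 := hasDerivAt_transport (v := ((-1, 0) : ℝ × ℝ)) hZ f (t, 0) 0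
  have h2 := hasDerivAt_transport (v := ((-1, 0) : ℝ × ℝ)) hZ g (t, 0) 0
  have h3 : (fun h : ℝ => (transport ((-1, 0) : ℝ × ℝ) Z Zi h f).1 (t, 0)) =
      fun h => (transport ((-1, 0) : ℝ × ℝ) Z Zi h g).1 (t, 0) := by
    ext1 h
    simp [hfg]
  rw [h3] at h1
  have h4 := h1.unique h2
  simpa only [transport_apply, zero_smul, add_zero, ← mul_assoc, hZ', one_mul] using h4

lemma splitGenerator_add_pow_apply (hH : ∀ k, ContDiff ℝ ∞ (H k))
    (hG : ContDiff ℝ ∞ fun s => ∑ k, H k s) (f : smoothFun (ℝ × ℝ) (E →L[ℂ] E)) (m : ℕ) (t : ℝ) :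
    (((splitGenerator hH false + splitGenerator hH true) ^ m) f).1 (t, 0) =
      ((transportGenerator (-1, 0) (initialFun hG) (finalFun hG) ^ m) f).1 (t, 0) := by
  induction m generalizing t with
  | zero => rfl
  | succ m ih =>
    rw [pow_succ', pow_succ', Module.End.mul_apply, Module.End.mul_apply,
      splitGenerator_add_apply hH hG]
    exact transportGenerator_congr_line
      (fun p => timeOrderedExp_mul_swap hG.continuous 0 p.1)
      (fun p => timeOrderedExp_mul_swap hG.continuous p.1 0) ih t

end Flows

/-! ### The local error of the scheme -/

lemma breakL_eq_add {q j : ℕ} (hj : j < q) (a b : ℕ → ℝ) (Δt : ℝ) :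
    breakL q a b Δt j = b j * Δt + breakL q a b Δt (j + 1) := by
  rw [breakL, breakL, Finset.sum_eq_sum_Ico_succ_bot hj, weightD]
  ring

lemma breakR_eq_sub {q j : ℕ} (hj : j < q) (a b : ℕ → ℝ) (Δt : ℝ) :
    breakR q a b Δt j = breakL q a b Δt j - weightC a b j * Δt := by
  rw [breakL_eq_add hj, breakR, breakL, weightD]
  ring

lemma breakL_zero (q : ℕ) (a b : ℕ → ℝ) (Δt : ℝ) :
    breakL q a b Δt 0 = Δt * ∑ j ∈ Finset.range q, b j := by
  rw [breakL, ← Finset.range_eq_Ico]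
  simp [weightD]

section Order

variable {E : Type*} [NormedAddCommGroup E] [InnerProductSpace ℂ E] [CompleteSpace E] {Λ : ℕ}
  {H : Fin Λ → ℝ → E →L[ℂ] E}

/-- One step of the scheme is the two-operator product formula for the flows `e^{hA}`, `e^{hB}`,
applied to the constant function `1` and evaluated on the line `s = 0`. -/
theorem flowProduct_splitFlow (hH : ∀ k, ContDiff ℝ ∞ (H k)) (q : ℕ) (a b : ℕ → ℝ) (t Δt : ℝ) :
    (flowProduct (splitFlow hH) ((a 0, false) :: cycleFactors a b q 0) (oneFun E) Δt).1
      (t + breakL q a b Δt 0, 0) = hdrStep q a b H t Δt := by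
  have key : ∀ r j : ℕ, j + r = q →
      (flowProduct (splitFlow hH) (cycleFactors a b r j) (oneFun E) Δt).1
        (t + breakL q a b Δt j, -(weightC a b j * Δt)) =
      ((List.range' j r).map fun k =>
        forwardSweep H (t + breakL q a b Δt k) (t + breakR q a b Δt k) *
        backwardSweep H (t + breakR q a b Δt k) (t + breakL q a b Δt (k + 1))).prod := by
    intro r
    induction r with
    | zero => intro j _; rfl
    | succ r ih =>
      intro j hj
      have hjq : j < q := by omega
      rw [List.range'_succ, List.map_cons, List.prod_cons, ← ih (j + 1) (by omega)]
      simp only [cycleFactors, flowProduct, splitFlow, transport_apply, forwardFun, backwardFun,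
        oneFun, one_mul, mul_assoc]
      have hR := breakR_eq_sub hjq a b Δt
      have hL := breakL_eq_add hjq a b Δt
      have e1 : t + breakL q a b Δt j + -(weightC a b j * Δt) = t + breakR q a b Δt j := by
        rw [hR]; ring
      have e2 : ((t + breakL q a b Δt j, -(weightC a b j * Δt)) : ℝ × ℝ) +
          (b j * Δt) • ((-1, 1) : ℝ × ℝ) =
          (t + breakL q a b Δt (j + 1), b j * Δt - weightC a b j * Δt) := by
        ext
        · simp only [Prod.fst_add, Prod.smul_fst, smul_eq_mul]; rw [hL]; ring
        · simp only [Prod.snd_add, Prod.smul_snd, smul_eq_mul]; ring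
      have e3 : ((t + breakL q a b Δt (j + 1), b j * Δt - weightC a b j * Δt) : ℝ × ℝ) +
          (a (j + 1) * Δt) • ((0, -1) : ℝ × ℝ) =
          (t + breakL q a b Δt (j + 1), -(weightC a b (j + 1) * Δt)) := by
        ext
        · simp
        · simp only [Prod.snd_add, Prod.smul_snd, smul_eq_mul, weightC]; ring
      have e4 : t + breakL q a b Δt (j + 1) + (b j * Δt - weightC a b j * Δt) =
          t + breakR q a b Δt j := by
        rw [hR, hL]; ring
      rw [e2, e3, e4, e1]
  rw [hdrStep, List.range_eq_range', ← key q 0 (zero_add q)]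
  simp [flowProduct, splitFlow, oneFun, weightC]

/-- The local error of the scheme is `O(Δt ^ (n + 1))`, locally uniformly in the initial time. -/
theorem norm_hdrStep_sub_le {n q : ℕ} {a b : ℕ → ℝ} (hab : IsProductFormula n q a b)
    (hH : ∀ k, ContDiff ℝ ∞ (H k)) (T : ℝ) :
    ∃ C δ : ℝ, 0 < δ ∧ ∀ t ∈ Set.Icc (-T) T, ∀ Δt : ℝ, |Δt| ≤ δ →
      ‖hdrStep q a b H t Δt - timeOrderedExp (fun s => ∑ k, H k s) (t + Δt) t‖ ≤
        C * |Δt| ^ (n + 1) := by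
  have hG : ContDiff ℝ ∞ fun s => ∑ k, H k s := ContDiff.sum fun k _ => hH k
  set l := (a 0, false) :: cycleFactors a b q 0 with hl
  set σ := ∑ j ∈ Finset.range q, b j with hσ
  obtain ⟨C₁, δ₁, hδ₁, h1⟩ := (smoothScale (ℝ × ℝ) (E →L[ℂ] E)).flowProduct_sub_mem
    (isFlow_splitFlow hH) n (oneFun E) l (T + |σ| + 1)
  obtain ⟨C₂, δ₂, hδ₂, h2⟩ := (isFlow_transport (v := ((-1, 0) : ℝ × ℝ))
    (Z := initialFun hG) (Zi := finalFun hG)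
    (fun p => timeOrderedExp_mul_swap hG.continuous 0 p.1)
    (fun p => timeOrderedExp_mul_swap hG.continuous p.1 0)).taylor 1 (n + 1) (oneFun E)
    (T + |σ| + 1)
  refine ⟨C₁ + C₂, min 1 (min δ₁ δ₂), by positivity, fun t ht Δt hΔ => ?_⟩
  have hΔ1 : |Δt| ≤ 1 := hΔ.trans (min_le_left _ _)
  have htT : |t| ≤ T := abs_le.2 ht
  have hp : ‖((t + breakL q a b Δt 0, 0) : ℝ × ℝ)‖ ≤ T + |σ| + 1 := by
    rw [breakL_zero, ← hσ]
    have h3 : |t + Δt * σ| ≤ T + |σ| + 1 := by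
      refine (abs_add_le _ _).trans ?_
      rw [abs_mul]
      have := mul_le_of_le_one_left (abs_nonneg σ) hΔ1
      linarith
    have h4 : 0 ≤ T + |σ| + 1 := (abs_nonneg _).trans h3
    simpa [Prod.norm_def, h4] using h3
  have hp' : ‖((t + Δt, 0) : ℝ × ℝ)‖ ≤ T + |σ| + 1 := by
    have h3 : |t + Δt| ≤ T + |σ| + 1 :=
      (abs_add_le _ _).trans (by linarith [abs_nonneg σ])
    have h4 : 0 ≤ T + |σ| + 1 := (abs_nonneg _).trans h3
    simpa [Prod.norm_def, h4] using h3
  have h1' := h1 Δt (hΔ.trans ((min_le_right _ _).trans (min_le_left _ _))) _ hp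
  have h2' := h2 Δt (hΔ.trans ((min_le_right _ _).trans (min_le_right _ _))) _ hp'
  have e1 : (flowProduct (splitFlow hH) l (oneFun E) Δt -
      ∑ m ∈ Finset.range (n + 1), Δt ^ m • formalCoeff (splitGenerator hH) l (oneFun E) m).1
        (t + breakL q a b Δt 0, 0) = hdrStep q a b H t Δt -
      ∑ m ∈ Finset.range (n + 1), Δt ^ m •
        (formalCoeff (splitGenerator hH) l (oneFun E) m).1 (t + breakL q a b Δt 0, 0) := by
    rw [← flowProduct_splitFlow hH]
    simp [Finset.sum_apply, hl]
  have e2 : (transport (-1, 0) (initialFun hG) (finalFun hG) (1 * Δt) (oneFun E) -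
      ∑ k ∈ Finset.range (n + 1), ((1 * Δt) ^ k / k.factorial) •
        (transportGenerator (-1, 0) (initialFun hG) (finalFun hG) ^ k) (oneFun E)).1
        (t + Δt, 0) = timeOrderedExp (fun s => ∑ k, H k s) (t + Δt) t -
      ∑ k ∈ Finset.range (n + 1), (Δt ^ k / k.factorial) •
        ((transportGenerator (-1, 0) (initialFun hG) (finalFun hG) ^ k) (oneFun E)).1
          (t + Δt, 0) := by
    have h3 : (transport (-1, 0) (initialFun hG) (finalFun hG) Δt (oneFun E)).1 (t + Δt, 0) =
        timeOrderedExp (fun s => ∑ k, H k s) (t + Δt) t := by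
      rw [transport_apply]
      simp [initialFun, finalFun, oneFun, timeOrderedExp_mul hG.continuous]
    rw [← h3]
    simp [Finset.sum_apply]
  -- the two Taylor polynomials agree
  have e3 : ∑ m ∈ Finset.range (n + 1), Δt ^ m •
        (formalCoeff (splitGenerator hH) l (oneFun E) m).1 (t + breakL q a b Δt 0, 0) =
      ∑ k ∈ Finset.range (n + 1), (Δt ^ k / k.factorial) •
        ((transportGenerator (-1, 0) (initialFun hG) (finalFun hG) ^ k) (oneFun E)).1
          (t + Δt, 0) := by
    rcases Nat.eq_zero_or_pos n with rfl | hn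
    · -- for order zero the end points may differ, but only the constant terms matter
      simp [formalCoeff_zero, oneFun]
    · rw [breakL_zero, hab.sum_b_eq_one hn, mul_one]
      refine Finset.sum_congr rfl fun m hm => ?_
      rw [hl, hab.formalCoeff_eq _ _ (Finset.mem_range_succ_iff.1 hm), Submodule.coe_smul,
        Pi.smul_apply, splitGenerator_add_pow_apply hH hG, smul_smul, div_eq_mul_inv]
  rw [e1, e3] at h1'
  rw [e2] at h2'
  rw [add_mul]
  refine (norm_sub_le_norm_sub_add_norm_sub _ _ _).trans (add_le_add h1' ?_)
  rwa [norm_sub_rev]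

end Order

end HDR

end

theorem mainTheorem1 {ℋ : Type*} [NormedAddCommGroup ℋ] [InnerProductSpace ℂ ℋ] [CompleteSpace ℋ]
    (n q Λ : ℕ) (hq : 1 ≤ q) (hΛ : 1 ≤ Λ)
    (a b : ℕ → ℝ) (hab : HDR.IsProductFormula n q a b)
    (H : Fin Λ → ℝ → ℋ →L[ℂ] ℋ) (hH : ∀ k, ContDiff ℝ ∞ (H k)) :
    -- order `n`: the one-step error is `O(Δt ^ (n + 1))`, locally uniformly in `t`
    (∀ T : ℝ, ∃ C δ : ℝ, 0 < δ ∧ ∀ t ∈ Set.Icc (-T) T, ∀ Δt : ℝ, |Δt| ≤ δ →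
      ‖HDR.hdrStep q a b H t Δt
          - HDR.timeOrderedExp (fun s => ∑ k, H k s) (t + Δt) t‖ ≤ C * |Δt| ^ (n + 1)) ∧
    -- every step is performed by a circuit with `2 Λ q - (2 q - 1)` local evolution gates
    (∀ t Δt : ℝ,
      HDR.evolutionCircuitOp H (HDR.hdrCircuit Λ q a b t Δt) = HDR.hdrStep q a b H t Δt ∧
      (HDR.hdrCircuit Λ q a b t Δt).length = 2 * Λ * q - (2 * q - 1)) ∧
    -- which is the number of gates of the time-independent formula
    (∀ τ : ℝ,
      (∀ A : Fin Λ → ℋ →L[ℂ] ℋ, HDR.expCircuitOp A (HDR.timeIndependentCircuit Λ q a b τ) =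
        HDR.multiOperatorProduct q a b A τ) ∧
      (HDR.timeIndependentCircuit Λ q a b τ).length = 2 * Λ * q - (2 * q - 1)) :=
  ⟨HDR.norm_hdrStep_sub_le hab hH,
    fun t Δt => ⟨HDR.evolutionCircuitOp_hdrCircuit q a b (fun k => (hH k).continuous) t Δt,
      HDR.length_hdrCircuit hΛ hq a b t Δt⟩,
    fun τ => ⟨fun A => HDR.expCircuitOp_timeIndependentCircuit q a b A τ,
      HDR.length_timeIndependentCircuit hΛ hq a b τ⟩⟩
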